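/- **Setting.** Let $d\ge 2$, let $\Omega\subset\mathbb R^d$ be a bounded domain (open, connected, non-empty), let $1<p<\infty$ with $p\ge \frac{2d}{d+2}$, let $T>0$, $I=(0,T)$, and $\delta\in[0,1]$. For a matrix $P\in\mathbb R^{d\times d}$ put $P^{\rm sym}=\frac12(P+P^\top)$, let $|\cdot|$ be the Hilbert–Schmidt norm, and set $$S(P)=(\delta+|P^{\rm sym}|)^{p-2}P^{\rm sym},\qquad F(P)=(\delta+|P^{\rm sym}|)^{\frac{p-2}{2}}P^{\rm sym}$$ (both are $0$ if $P^{\rm sym}=0$). For a vector field $v$ with weak gradient $\nabla v$ let $Dv=(\nabla v)^{\rm sym}$; $(\cdot,\cdot)$ is the $L^2(\Omega)$ inner product of scalar, vector or tensor fields. $W^{1,p}_0(\Omega)$ is the closure of $C_0^\infty(\Omega)^d$ in $W^{1,p}(\Omega)^d$, $\|v\|_{W^{1,p}}=\|v\|_{L^p}+\|\nabla v\|_{L^p}$, and $W^{1,p}_{0,\rm div}(\Omega)=\{v\in W^{1,p}_0(\Omega):\operatorname{div}v=0\text{ a.e.}\}$. Let $p'=p/(p-1)$. Let $\mathcal T_h$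 be a finite decomposition of $\Omega$ into open simplices $T\subset\Omega$ whose closures cover $\overline\Omega$, any two of which meet in a common face or not at all, with $h_T\le\sigma_0\rho_T$ for all $T$ ($h_T$ the diameter of $T$, $\rho_T$ the diameter of the largest closed ball in $\overline T$). Let $S_T$ be the interior of the union of all closed simplices that meet $\overline T$. Let $\mathcal P_l(\mathcal T_h)$ be the space of functions that are continuous on $\overline\Omega$ and polynomial of degree $\le l$ on each $T$. For $k,r\in\mathbb N_0$ let $X_h$ be a linear subspace (for instance all) of $\{v\in W^{1,p}_0(\Omega): v|_T \text{ is a polynomial field of degree}\le k\ \forall T\}$ and $Y_h$ a linear subspace (for instance all) of $\{q\in L^{p'}(\Omega): q|_T\text{ is a polynomial of degree}\le r\ \forall T\}$, and $$V_h=\{v\in X_h:(q,\operatorname{div}v)=0\ \ \forall q\in Y_h\}.$$ Assume that $\mathcal P_1(\mathcal T_h)^d\cap W_0^{1,p}(\Omega)\subset X_h$, $\mathcal P_0(\mathcal T_h)\subset Y_h$, and that there are linear projections $\Pi^{\rm div}:W_0^{1,p}(\Omega)\to X_h$ and $\Pi^Y:L^{p'}(\Omega)\to Y_h$ and a constant $\kappa$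 such that, for all $w\in W_0^{1,p}(\Omega)$, $\eta\in Y_h$, $q\in L^{p'}(\Omega)$ and $T\in\mathcal T_h$: $(\operatorname{div}w,\eta)=(\operatorname{div}\Pi^{\rm div}w,\eta)$; $\frac1{|T|}\int_T|\Pi^{\rm div}w|\le\frac{\kappa}{|S_T|}\int_{S_T}|w|+\frac{\kappa}{|S_T|}\int_{S_T}h_T|\nabla w|$; $\Pi^{\rm div}w=w$ if $w\in\mathcal P_1(\mathcal T_h)^d$; $\frac1{|T|}\int_T|\Pi^Yq|\le\frac{\kappa}{|S_T|}\int_{S_T}|q|$. **Theorem.** For all $M_1,M_2>0$ there is a constant $c$, depending only on $d,p,\Omega,T,M_1,M_2$ (in particular not on the mesh $\mathcal T_h$ or its size $h=\max_T h_T$), such that the following holds for every $\delta$, $\mathcal T_h$, $X_h$, $Y_h$ as above. Let $f\in W^{1,2}(I,L^2(\Omega)^d)$, identified with its continuous representative on $\overline I=[0,T]$, and $u_0\in W^{1,p}_{0,\rm div}(\Omega)$ satisfy $$\|f\|_{L^2(I,L^2(\Omega))}+\|\partial_tf\|_{L^2(I,L^2(\Omega))}+\|u_0\|_{W^{1,p}(\Omega)}\le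 M_1,$$ and let $u_0^h\in V_h$ satisfy $\|u_0^h\|_{W^{1,p}(\Omega)}\le M_2$. Then there is a unique $u_h\in C^1(\overline I,V_h)$ such that $u_h(0)=u_0^h$ and, for every $t\in\overline I$, $$(\partial_tu_h(t),\xi_h)+(S(Du_h(t)),D\xi_h)=(f(t),\xi_h)\qquad\forall\,\xi_h\in V_h .$$ Moreover $F(Du_h)\in L^2(I,L^2(\Omega))\cap L^\infty(I,L^2(\Omega))$ and $$\|u_h\|_{L^\infty(I,L^2(\Omega))}+\|F(Du_h)\|_{L^2(I,L^2(\Omega))}\le c,\qquad \|\partial_tu_h\|_{L^2(I,L^2(\Omega))}+\|F(Du_h)\|_{L^\infty(I,L^2(\Omega))}\le c .$$ -/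

import Mathlib

open MeasureTheory Set Filter Topology
open scoped ENNReal ContDiff

namespace GenStokes

noncomputable section

/-! ### Vectors, tensors, extra stress -/

/-- Vectors of `ℝᵈ` with the Euclidean norm. -/
abbrev Vec (d : ℕ) : Type := EuclideanSpace ℝ (Fin d)

/-- `d × d` tensors. The inner product is the component-wise one `A : B`, and the norm is the
Hilbert-Schmidt norm. -/
abbrev Tensor (d : ℕ) : Type := EuclideanSpace ℝ (Fin d × Fin d)

/-- The symmetric part `(A + Aᵀ) / 2`. -/
def symPart {d : ℕ} (A : Tensor d) : Tensor d :=
  WithLp.toLp 2 fun ij => (A ij + A (ij.2, ij.1)) / 2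

/-- `φ'(s) = (δ + s)^(p-2) s`, the derivative of the `N`-function `φ` with `(p, δ)`-structure. -/
def phiDeriv (p δ s : ℝ) : ℝ := (δ + s) ^ (p - 2) * s

/-- The extra stress tensor with `N`-potential `φ`:
`S(P) = φ'(|Pˢʸᵐ|) / |Pˢʸᵐ| Pˢʸᵐ`, which is `0` if `Pˢʸᵐ = 0`. -/
def stress {d : ℕ} (p δ : ℝ) (P : Tensor d) : Tensor d :=
  (phiDeriv p δ ‖symPart P‖ / ‖symPart P‖) • symPart P

/-- `F(P) = (δ + |Pˢʸᵐ|)^((p-2)/2) Pˢʸᵐ`, which is `0` if `Pˢʸᵐ = 0`. -/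
def natF {d : ℕ} (p δ : ℝ) (P : Tensor d) : Tensor d :=
  ((δ + ‖symPart P‖) ^ ((p - 2) / 2)) • symPart P

/-! ### Weak gradients and Sobolev spaces -/

/-- Lebesgue measure on `Ω`. -/
abbrev dom {d : ℕ} (Ω : Set (Vec d)) : Measure (Vec d) := volume.restrict Ω

/-- Classes of (strongly measurable) vector fields on `Ω` modulo equality almost everywhere. -/
abbrev Field (d : ℕ) (Ω : Set (Vec d)) : Type := Vec d →ₘ[dom Ω] Vec d

/-- Classes of scalar functions on `Ω` modulo equality almost everywhere. -/
abbrev Scalar (d : ℕ) (Ω : Set (Vec d)) : Type := Vec d →ₘ[dom Ω] ℝ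

/-- The Hilbert space `L²(Ω)` of vector fields. -/
abbrev L2 (d : ℕ) (Ω : Set (Vec d)) : Type := Lp (Vec d) 2 (dom Ω)

/-- The Hilbert space `L²(Ω)` of tensor fields. -/
abbrev L2T (d : ℕ) (Ω : Set (Vec d)) : Type := Lp (Tensor d) 2 (dom Ω)

/-- The conjugate exponent `p' = p / (p - 1)` as an extended nonnegative real. -/
def conjExp (p : ℝ) : ℝ≥0∞ := ENNReal.ofReal (p / (p - 1))

/-- `G` is the weak gradient of `v` on `Ω`, with `G (i, j) = ∂ᵢ vⱼ`. -/
structure HasWeakGrad {d : ℕ} (Ω : Set (Vec d)) (v : Vec d → Vec d) (G : Vec d → Tensor d) :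
    Prop where
  locInt : LocallyIntegrableOn v Ω volume
  locInt_grad : LocallyIntegrableOn G Ω volume
  integral_eq : ∀ η : Vec d → ℝ, ContDiff ℝ ∞ η → HasCompactSupport η → tsupport η ⊆ Ω →
    ∀ i j : Fin d,
      ∫ x in Ω, fderiv ℝ η x (EuclideanSpace.single i 1) * v x j = -∫ x in Ω, η x * G x (i, j)

open Classical in
/-- The weak gradient of `v` on `Ω` (unique up to null sets); `0` if there is none. -/
def weakGrad {d : ℕ} (Ω : Set (Vec d)) (v : Vec d → Vec d) : Vec d → Tensor d :=
  if h : ∃ G, HasWeakGrad Ω v G then h.choose else 0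

/-- The symmetric gradient `Dv`. -/
def symGrad {d : ℕ} (Ω : Set (Vec d)) (v : Vec d → Vec d) (x : Vec d) : Tensor d :=
  symPart (weakGrad Ω v x)

/-- The weak divergence. -/
def weakDiv {d : ℕ} (Ω : Set (Vec d)) (v : Vec d → Vec d) (x : Vec d) : ℝ :=
  ∑ i, weakGrad Ω v x (i, i)

/-- The classical gradient of a differentiable field, `(i, j) ↦ ∂ᵢ vⱼ`. -/
def classGrad {d : ℕ} (v : Vec d → Vec d) (x : Vec d) : Tensor d :=
  WithLp.toLp 2 fun ij => (fderiv ℝ v x (EuclideanSpace.single ij.1 1)) ij.2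

/-- The norm of `W^{1,p}(Ω)` of a field that has a weak gradient. -/
def sobolevNorm {d : ℕ} (p : ℝ) (Ω : Set (Vec d)) (v : Vec d → Vec d) : ℝ≥0∞ :=
  eLpNorm v (ENNReal.ofReal p) (dom Ω) + eLpNorm (weakGrad Ω v) (ENNReal.ofReal p) (dom Ω)

/-- Membership in `W₀^{1,p}(Ω)`: `v` is a `W^{1,p}`-limit of fields in `C₀^∞(Ω)`. -/
def MemW0 {d : ℕ} (p : ℝ) (Ω : Set (Vec d)) (v : Vec d → Vec d) : Prop :=
  ∃ G : Vec d → Tensor d, HasWeakGrad Ω v G ∧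
    MemLp v (ENNReal.ofReal p) (dom Ω) ∧ MemLp G (ENNReal.ofReal p) (dom Ω) ∧
    ∃ η : ℕ → Vec d → Vec d,
      (∀ n, ContDiff ℝ ∞ (η n) ∧ HasCompactSupport (η n) ∧ tsupport (η n) ⊆ Ω) ∧
      Tendsto (fun n => eLpNorm (v - η n) (ENNReal.ofReal p) (dom Ω)) atTop (𝓝 0) ∧
      Tendsto (fun n => eLpNorm (G - classGrad (η n)) (ENNReal.ofReal p) (dom Ω)) atTop (𝓝 0)

theorem HasWeakGrad.congr {d : ℕ} {Ω : Set (Vec d)} {v w : Vec d → Vec d} {G H : Vec d → Tensor d}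
    (h : HasWeakGrad Ω v G) (hvw : v =ᵐ[dom Ω] w) (hGH : G =ᵐ[dom Ω] H) : HasWeakGrad Ω w H := by
  refine ⟨h.locInt.congr hvw, h.locInt_grad.congr hGH, fun η h1 h2 h3 i j => ?_⟩
  have e1 : ∫ x in Ω, fderiv ℝ η x (EuclideanSpace.single i 1) * w x j
      = ∫ x in Ω, fderiv ℝ η x (EuclideanSpace.single i 1) * v x j :=
    integral_congr_ae (by filter_upwards [hvw] with x hx; rw [hx])
  have e2 : ∫ x in Ω, η x * H x (i, j) = ∫ x in Ω, η x * G x (i, j) :=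
    integral_congr_ae (by filter_upwards [hGH] with x hx; rw [hx])
  rw [e1, e2, h.integral_eq η h1 h2 h3 i j]

theorem integrableOn_mul_coord {d : ℕ} {ι : Type*} [Fintype ι] {Ω : Set (Vec d)} {g : Vec d → ℝ}
    {v : Vec d → EuclideanSpace ℝ ι} (hv : LocallyIntegrableOn v Ω volume) (hg : Continuous g)
    (hc : HasCompactSupport g) (hs : tsupport g ⊆ Ω) (j : ι) :
    IntegrableOn (fun x => g x * v x j) Ω volume := by
  have h1 : IntegrableOn v (tsupport g) volume := hv.integrableOn_compact_subset hs hc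
  have h2 : IntegrableOn (fun x => v x j) (tsupport g) volume :=
    (EuclideanSpace.proj j : EuclideanSpace ℝ ι →L[ℝ] ℝ).integrable_comp h1
  have h3 : IntegrableOn (fun x => g x * v x j) (tsupport g) volume :=
    h2.continuousOn_mul hg.continuousOn hc
  have h4 : Integrable (fun x => g x * v x j) volume := by
    refine h3.integrable_of_forall_notMem_eq_zero fun x hx => ?_
    simp [image_eq_zero_of_notMem_tsupport hx]
  exact h4.integrableOn

theorem integrableOn_fderiv_mul_coord {d : ℕ} {Ω : Set (Vec d)} {η : Vec d → ℝ}
    {v : Vec d → Vec d} (hv : LocallyIntegrableOn v Ω volume) (hg : ContDiff ℝ ∞ η)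
    (hc : HasCompactSupport η) (hs : tsupport η ⊆ Ω) (i j : Fin d) :
    IntegrableOn (fun x => fderiv ℝ η x (EuclideanSpace.single i 1) * v x j) Ω volume := by
  have hsub : tsupport (fun x => fderiv ℝ η x (EuclideanSpace.single i 1)) ⊆ tsupport η :=
    tsupport_fderiv_apply_subset ℝ _
  refine integrableOn_mul_coord hv ?_ (hc.fderiv_apply ℝ _) (hsub.trans hs) j
  exact (hg.continuous_fderiv (by simp)).clm_apply continuous_const

theorem HasWeakGrad.add {d : ℕ} {Ω : Set (Vec d)} {v w : Vec d → Vec d} {G H : Vec d → Tensor d}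
    (h : HasWeakGrad Ω v G) (h' : HasWeakGrad Ω w H) : HasWeakGrad Ω (v + w) (G + H) := by
  refine ⟨h.locInt.add h'.locInt, h.locInt_grad.add h'.locInt_grad, fun η h1 h2 h3 i j => ?_⟩
  simp only [Pi.add_apply, PiLp.add_apply, mul_add]
  rw [integral_add (integrableOn_fderiv_mul_coord h.locInt h1 h2 h3 i j)
      (integrableOn_fderiv_mul_coord h'.locInt h1 h2 h3 i j),
    integral_add (integrableOn_mul_coord h.locInt_grad h1.continuous h2 h3 (i, j))
      (integrableOn_mul_coord h'.locInt_grad h1.continuous h2 h3 (i, j)),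
    h.integral_eq η h1 h2 h3 i j, h'.integral_eq η h1 h2 h3 i j]
  ring

theorem HasWeakGrad.const_smul {d : ℕ} {Ω : Set (Vec d)} {v : Vec d → Vec d}
    {G : Vec d → Tensor d} (h : HasWeakGrad Ω v G) (c : ℝ) : HasWeakGrad Ω (c • v) (c • G) := by
  refine ⟨h.locInt.smul c, h.locInt_grad.smul c, fun η h1 h2 h3 i j => ?_⟩
  simp only [Pi.smul_apply, PiLp.smul_apply, smul_eq_mul, mul_left_comm _ c]
  rw [integral_const_mul, integral_const_mul, h.integral_eq η h1 h2 h3 i j]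
  ring

theorem HasWeakGrad.zero {d : ℕ} (Ω : Set (Vec d)) :
    HasWeakGrad Ω (0 : Vec d → Vec d) (0 : Vec d → Tensor d) :=
  ⟨(locallyIntegrable_zero (μ := volume)).locallyIntegrableOn Ω,
    (locallyIntegrable_zero (μ := volume)).locallyIntegrableOn Ω, by simp⟩

theorem tendsto_eLpNorm_add {d : ℕ} {ι : Type*} [Fintype ι] {q : ℝ≥0∞} {μ : Measure (Vec d)}
    {a b : ℕ → Vec d → EuclideanSpace ℝ ι} (ha : ∀ n, AEStronglyMeasurable (a n) μ)
    (hb : ∀ n, AEStronglyMeasurable (b n) μ)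
    (ha' : Tendsto (fun n => eLpNorm (a n) q μ) atTop (𝓝 0))
    (hb' : Tendsto (fun n => eLpNorm (b n) q μ) atTop (𝓝 0)) :
    Tendsto (fun n => eLpNorm (a n + b n) q μ) atTop (𝓝 0) := by
  have h : Tendsto (fun n => ENNReal.LpAddConst q * (eLpNorm (a n) q μ + eLpNorm (b n) q μ))
      atTop (𝓝 0) := by
    have h1 := ENNReal.Tendsto.const_mul (ha'.add hb') (Or.inr (ENNReal.LpAddConst_lt_top q).ne)
    simpa using h1
  exact tendsto_of_tendsto_of_tendsto_of_le_of_le tendsto_const_nhds h (fun _ => zero_le)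
    fun n => eLpNorm_add_le' (ha n) (hb n) q

theorem continuous_classGrad {d : ℕ} {η : Vec d → Vec d} (h : ContDiff ℝ ∞ η) :
    Continuous (classGrad η) := by
  have h1 := h.continuous_fderiv (by simp)
  refine (PiLp.continuous_toLp 2 _).comp (continuous_pi fun ij => ?_)
  exact (EuclideanSpace.proj ij.2 : Vec d →L[ℝ] ℝ).continuous.comp
    (h1.clm_apply continuous_const)

theorem MemW0.congr {d : ℕ} {p : ℝ} {Ω : Set (Vec d)} {v w : Vec d → Vec d} (h : MemW0 p Ω v)
    (hvw : v =ᵐ[dom Ω] w) : MemW0 p Ω w := by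
  obtain ⟨G, hG, hv, hGp, η, hη, h1, h2⟩ := h
  refine ⟨G, hG.congr hvw .rfl, hv.ae_eq hvw, hGp, η, hη, ?_, h2⟩
  refine h1.congr fun n => eLpNorm_congr_ae ?_
  filter_upwards [hvw] with x hx
  simp [hx]

theorem MemW0.add {d : ℕ} {p : ℝ} {Ω : Set (Vec d)} {v w : Vec d → Vec d} (h : MemW0 p Ω v)
    (h' : MemW0 p Ω w) : MemW0 p Ω (v + w) := by
  obtain ⟨G, hG, hv, hGp, η, hη, h1, h2⟩ := h
  obtain ⟨H, hH, hw, hHp, ζ, hζ, k1, k2⟩ := h'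
  refine ⟨G + H, hG.add hH, hv.add hw, hGp.add hHp, fun n => η n + ζ n, fun n =>
    ⟨(hη n).1.add (hζ n).1, (hη n).2.1.add (hζ n).2.1,
      (tsupport_add _ _).trans (union_subset (hη n).2.2 (hζ n).2.2)⟩, ?_, ?_⟩
  · refine (tendsto_eLpNorm_add
      (fun n => hv.1.sub (hη n).1.continuous.aestronglyMeasurable)
      (fun n => hw.1.sub (hζ n).1.continuous.aestronglyMeasurable) h1 k1).congr fun n => ?_
    congr 1
    exact (add_sub_add_comm v w (η n) (ζ n)).symm
  · refine (tendsto_eLpNorm_add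
      (fun n => hGp.1.sub (continuous_classGrad (hη n).1).aestronglyMeasurable)
      (fun n => hHp.1.sub (continuous_classGrad (hζ n).1).aestronglyMeasurable) h2 k2).congr
      fun n => ?_
    congr 1
    ext x ij
    have e1 := ((hη n).1.differentiable (by simp)) x
    have e2 := ((hζ n).1.differentiable (by simp)) x
    simp [classGrad, fderiv_add e1 e2]
    ring

theorem MemW0.const_smul {d : ℕ} {p : ℝ} {Ω : Set (Vec d)} {v : Vec d → Vec d} (h : MemW0 p Ω v)
    (c : ℝ) : MemW0 p Ω (c • v) := by
  obtain ⟨G, hG, hv, hGp, η, hη, h1, h2⟩ := h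
  refine ⟨c • G, hG.const_smul c, hv.const_smul c, hGp.const_smul c, fun n => c • η n, fun n =>
    ⟨(hη n).1.const_smul c, (hη n).2.1.smul_left (f := fun _ => c),
      (tsupport_smul_subset_right (fun _ => c) _).trans (hη n).2.2⟩, ?_, ?_⟩
  · have := ENNReal.Tendsto.const_mul (a := ‖c‖ₑ) h1 (Or.inr (by simp))
    simp only [mul_zero] at this
    refine this.congr fun n => ?_
    rw [← eLpNorm_const_smul, smul_sub]
  · have := ENNReal.Tendsto.const_mul (a := ‖c‖ₑ) h2 (Or.inr (by simp))
    simp only [mul_zero] at this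
    refine this.congr fun n => ?_
    rw [← eLpNorm_const_smul, smul_sub]
    congr 2
    ext x ij
    have e1 := ((hη n).1.differentiable (by simp)) x
    simp [classGrad, fderiv_const_smul e1]

theorem MemW0.zero {d : ℕ} (p : ℝ) (Ω : Set (Vec d)) : MemW0 p Ω (0 : Vec d → Vec d) := by
  have hz : classGrad (0 : Vec d → Vec d) = 0 := by
    ext x ij
    simp [classGrad]
  refine ⟨0, .zero Ω, MemLp.zero, MemLp.zero, fun _ => 0, fun _ =>
    ⟨contDiff_const, .zero, by simp [tsupport]⟩, ?_, ?_⟩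
  · simp
  · simp [hz]

/-- `W₀^{1,p}(Ω)` as a space of classes of vector fields. -/
def W0 {d : ℕ} (p : ℝ) (Ω : Set (Vec d)) : Submodule ℝ (Field d Ω) where
  carrier := {v | MemW0 p Ω v}
  add_mem' {v w} hv hw := (MemW0.add hv hw).congr (AEEqFun.coeFn_add v w).symm
  zero_mem' := (MemW0.zero p Ω).congr AEEqFun.coeFn_zero.symm
  smul_mem' c v hv := (MemW0.const_smul hv c).congr (AEEqFun.coeFn_smul c v).symm

/-- `W^{1,p}_{0,div}(Ω)`: the fields in `W₀^{1,p}(Ω)` with divergence zero a.e. in `Ω`. -/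
def W0div {d : ℕ} (p : ℝ) (Ω : Set (Vec d)) : Set (Field d Ω) :=
  {v | v ∈ W0 p Ω ∧ weakDiv Ω v =ᵐ[dom Ω] 0}

/-! ### Triangulations and finite element spaces -/

/-- A finite decomposition of `Ω` into (open) simplices without hanging nodes. A simplex is given
by the set of its `d + 1` vertices. -/
structure Mesh {d : ℕ} (Ω : Set (Vec d)) where
  cells : Finset (Finset (Vec d))
  card_eq : ∀ s ∈ cells, s.card = d + 1
  affineIndep : ∀ s ∈ cells, AffineIndependent ℝ ((↑) : s → Vec d)
  conforming : ∀ s ∈ cells, ∀ t ∈ cells,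
    convexHull ℝ (s : Set (Vec d)) ∩ convexHull ℝ (t : Set (Vec d))
      = convexHull ℝ ((s : Set (Vec d)) ∩ t)
  subset : ∀ s ∈ cells, interior (convexHull ℝ (s : Set (Vec d))) ⊆ Ω
  cover : ⋃ s ∈ cells, convexHull ℝ (s : Set (Vec d)) = closure Ω

/-- The closed simplex with vertex set `s`. -/
def closedCell {d : ℕ} (s : Finset (Vec d)) : Set (Vec d) := convexHull ℝ (s : Set (Vec d))

/-- The open simplex with vertex set `s`. -/
def openCell {d : ℕ} (s : Finset (Vec d)) : Set (Vec d) := interior (closedCell s)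

/-- The diameter `ρ_T` of the largest closed ball contained in the closed simplex. -/
def inDiam {d : ℕ} (s : Finset (Vec d)) : ℝ :=
  sSup {ρ | ∃ (x : Vec d) (r : ℝ), 0 ≤ r ∧ Metric.closedBall x r ⊆ closedCell s ∧ ρ = 2 * r}

/-- Non-degeneracy: `h_T ≤ σ₀ ρ_T` for all simplices. -/
def Mesh.Nondegenerate {d : ℕ} {Ω : Set (Vec d)} (𝒯 : Mesh Ω) (σ₀ : ℝ) : Prop :=
  ∀ s ∈ 𝒯.cells, Metric.diam (closedCell s) ≤ σ₀ * inDiam s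

/-- The patch `S_T`: the interior of the union of all closed simplices that touch the given one. -/
def Mesh.patch {d : ℕ} {Ω : Set (Vec d)} (𝒯 : Mesh Ω) (s : Finset (Vec d)) : Set (Vec d) :=
  interior (⋃ t ∈ {t : Finset (Vec d) | t ∈ 𝒯.cells ∧ (closedCell t ∩ closedCell s).Nonempty}, closedCell t)

/-- On every simplex, `g` is (a.e. equal to) a polynomial of total degree at most `l`. -/
def IsPwPoly {d : ℕ} {Ω : Set (Vec d)} (𝒯 : Mesh Ω) (l : ℕ) (g : Vec d → ℝ) : Prop :=
  ∀ s ∈ 𝒯.cells, ∃ P : MvPolynomial (Fin d) ℝ, P.totalDegree ≤ l ∧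
    ∀ᵐ x ∂(volume.restrict (openCell s)), g x = MvPolynomial.eval (fun i => x i) P

/-- Scalar functions in `𝒫_l(𝒯)`: continuous on the closure of `Ω`, piecewise polynomial. -/
def ContPw {d : ℕ} {Ω : Set (Vec d)} (𝒯 : Mesh Ω) (l : ℕ) : Set (Scalar d Ω) :=
  {q | ∃ g : Vec d → ℝ, ContinuousOn g (closure Ω) ∧ q =ᵐ[dom Ω] g ∧ IsPwPoly 𝒯 l g}

/-- Vector fields with components in `𝒫_l(𝒯)`. -/
def ContPwVec {d : ℕ} {Ω : Set (Vec d)} (𝒯 : Mesh Ω) (l : ℕ) : Set (Field d Ω) :=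
  {v | ∃ g : Vec d → Vec d, ContinuousOn g (closure Ω) ∧ v =ᵐ[dom Ω] g ∧
    ∀ j, IsPwPoly 𝒯 l fun x => g x j}

theorem Mesh.ae_openCell {d : ℕ} {Ω : Set (Vec d)} (𝒯 : Mesh Ω) {s : Finset (Vec d)}
    (hs : s ∈ 𝒯.cells) {q : Vec d → Prop} (h : ∀ᵐ x ∂(dom Ω), q x) :
    ∀ᵐ x ∂(volume.restrict (openCell s)), q x :=
  ae_mono (Measure.restrict_mono_set volume (𝒯.subset s hs)) h

theorem IsPwPoly.congr {d : ℕ} {Ω : Set (Vec d)} {𝒯 : Mesh Ω} {l : ℕ} {g g' : Vec d → ℝ}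
    (h : IsPwPoly 𝒯 l g) (hg : g =ᵐ[dom Ω] g') : IsPwPoly 𝒯 l g' := by
  intro s hs
  obtain ⟨P, hP, hgP⟩ := h s hs
  refine ⟨P, hP, ?_⟩
  filter_upwards [hgP, 𝒯.ae_openCell hs hg] with x h1 h2
  rw [← h2, h1]

theorem IsPwPoly.add {d : ℕ} {Ω : Set (Vec d)} {𝒯 : Mesh Ω} {l : ℕ} {g g' : Vec d → ℝ}
    (h : IsPwPoly 𝒯 l g) (h' : IsPwPoly 𝒯 l g') : IsPwPoly 𝒯 l fun x => g x + g' x := by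
  intro s hs
  obtain ⟨P, hP, hgP⟩ := h s hs
  obtain ⟨Q, hQ, hgQ⟩ := h' s hs
  refine ⟨P + Q, (MvPolynomial.totalDegree_add P Q).trans (max_le hP hQ), ?_⟩
  filter_upwards [hgP, hgQ] with x h1 h2
  simp [h1, h2]

theorem IsPwPoly.const_mul {d : ℕ} {Ω : Set (Vec d)} {𝒯 : Mesh Ω} {l : ℕ} {g : Vec d → ℝ}
    (h : IsPwPoly 𝒯 l g) (c : ℝ) : IsPwPoly 𝒯 l fun x => c * g x := by
  intro s hs
  obtain ⟨P, hP, hgP⟩ := h s hs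
  refine ⟨c • P, (MvPolynomial.totalDegree_smul_le c P).trans hP, ?_⟩
  filter_upwards [hgP] with x h1
  simp [h1]

theorem IsPwPoly.zero {d : ℕ} {Ω : Set (Vec d)} (𝒯 : Mesh Ω) (l : ℕ) :
    IsPwPoly 𝒯 l fun _ => 0 :=
  fun _ _ => ⟨0, by simp, by simp⟩

/-- The full velocity space: fields in `W₀^{1,p}(Ω)` whose components are polynomials of degree at
most `k` on every simplex. -/
def velocitySpace {d : ℕ} {Ω : Set (Vec d)} (p : ℝ) (𝒯 : Mesh Ω) (k : ℕ) :
    Submodule ℝ (Field d Ω) where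
  carrier := {v | v ∈ W0 p Ω ∧ ∀ j, IsPwPoly 𝒯 k fun x => v x j}
  add_mem' {v w} hv hw := ⟨add_mem hv.1 hw.1, fun j => ((hv.2 j).add (hw.2 j)).congr (by
    filter_upwards [AEEqFun.coeFn_add v w] with x hx
    simp [hx])⟩
  zero_mem' := ⟨zero_mem _, fun j => (IsPwPoly.zero 𝒯 k).congr (by
    filter_upwards [AEEqFun.coeFn_zero (μ := dom Ω) (β := Vec d)] with x hx
    simp [hx])⟩
  smul_mem' c v hv := ⟨Submodule.smul_mem _ c hv.1, fun j => ((hv.2 j).const_mul c).congr (by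
    filter_upwards [AEEqFun.coeFn_smul c v] with x hx
    simp [hx])⟩

/-- The full pressure space: functions in `L^{p'}(Ω)` that are polynomials of degree at most `r`
on every simplex. -/
def pressureSpace {d : ℕ} {Ω : Set (Vec d)} (p : ℝ) (𝒯 : Mesh Ω) (r : ℕ) :
    Submodule ℝ (Scalar d Ω) where
  carrier := {q | q ∈ Lp.LpSubmodule ℝ ℝ (conjExp p) (dom Ω) ∧ IsPwPoly 𝒯 r q}
  add_mem' {v w} hv hw := ⟨add_mem hv.1 hw.1, (hv.2.add hw.2).congr (by
    filter_upwards [AEEqFun.coeFn_add v w] with x hx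
    simp [hx])⟩
  zero_mem' := ⟨zero_mem _, (IsPwPoly.zero 𝒯 r).congr (by
    filter_upwards [AEEqFun.coeFn_zero (μ := dom Ω) (β := ℝ)] with x hx
    simp [hx])⟩
  smul_mem' c v hv := ⟨Submodule.smul_mem _ c hv.1, (hv.2.const_mul c).congr (by
    filter_upwards [AEEqFun.coeFn_smul c v] with x hx
    simp [hx])⟩

/-- The discretely divergence-free fields `V_h = {v ∈ X | (q, div v) = 0 for all q ∈ Y}`. -/
def discDivFree {d : ℕ} {Ω : Set (Vec d)} (X : Submodule ℝ (Field d Ω))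
    (Y : Submodule ℝ (Scalar d Ω)) : Set (Field d Ω) :=
  {v | v ∈ X ∧ ∀ q ∈ Y, ∫ x in Ω, q x * weakDiv Ω v x = 0}

/-- The standing assumption on the pair `(X, Y)`: it contains the lowest order spaces, and there
are a divergence-preserving, locally `W^{1,1}`-stable linear projection into `X` and a locally
`L¹`-stable linear projection into `Y`, with stability constant `κ`. -/
structure Admissible {d : ℕ} {Ω : Set (Vec d)} (p : ℝ) (𝒯 : Mesh Ω)
    (X : Submodule ℝ (Field d Ω)) (Y : Submodule ℝ (Scalar d Ω)) (κ : ℝ) : Prop where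
  linear_mem : ∀ w ∈ ContPwVec 𝒯 1, w ∈ W0 p Ω → w ∈ X
  const_mem : ∀ q ∈ ContPw 𝒯 0, q ∈ Y
  exists_velocity : ∃ Λ : W0 p Ω →ₗ[ℝ] X,
    (∀ w w' : W0 p Ω, (w' : Field d Ω) = Λ w → Λ w' = Λ w) ∧
    (∀ w : W0 p Ω, ∀ η ∈ Y, ∫ x in Ω, weakDiv Ω (w : Field d Ω) x * η x
      = ∫ x in Ω, weakDiv Ω (Λ w : Field d Ω) x * η x) ∧
    (∀ w : W0 p Ω, ∀ s ∈ 𝒯.cells,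
      ⨍ x in openCell s, ‖(Λ w : Field d Ω) x‖
        ≤ κ * (⨍ x in 𝒯.patch s, ‖(w : Field d Ω) x‖)
          + κ * ⨍ x in 𝒯.patch s, Metric.diam (closedCell s) * ‖weakGrad Ω (w : Field d Ω) x‖) ∧
    (∀ w : W0 p Ω, (w : Field d Ω) ∈ ContPwVec 𝒯 1 → (Λ w : Field d Ω) = w)
  exists_pressure : ∃ Λ : Lp.LpSubmodule ℝ ℝ (conjExp p) (dom Ω) →ₗ[ℝ] Y,
    (∀ q q' : Lp.LpSubmodule ℝ ℝ (conjExp p) (dom Ω), (q' : Scalar d Ω) = Λ q → Λ q' = Λ q) ∧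
    (∀ q : Lp.LpSubmodule ℝ ℝ (conjExp p) (dom Ω), ∀ s ∈ 𝒯.cells,
      ⨍ x in openCell s, ‖(Λ q : Scalar d Ω) x‖ ≤ κ * ⨍ x in 𝒯.patch s, ‖(q : Scalar d Ω) x‖)

/-! ### Time-dependent functions and the semi-discrete problem -/

/-- Lebesgue measure on the time interval `I = (0, T)`. -/
abbrev timeMeas (T : ℝ) : Measure ℝ := volume.restrict (Ioo 0 T)

/-- `f ∈ W^{1,2}(I, L²(Ω))` with weak time derivative `f'`. Here `f` is the representative that is
continuous on the closed interval, so that `f t` makes sense for every `t` in it. -/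
structure IsW12 {d : ℕ} {Ω : Set (Vec d)} (T : ℝ) (f f' : ℝ → L2 d Ω) : Prop where
  continuousOn : ContinuousOn f (Icc 0 T)
  memLp : MemLp f 2 (timeMeas T)
  memLp_deriv : MemLp f' 2 (timeMeas T)
  integral_eq : ∀ η : ℝ → ℝ, ContDiff ℝ ∞ η → HasCompactSupport η → tsupport η ⊆ Ioo 0 T →
    ∫ t in Ioo 0 T, deriv η t • f t = -∫ t in Ioo 0 T, η t • f' t

/-- `u ∈ C¹([0,T], V)` solves the semi-discrete generalized Stokes problem with right-hand side `f`
and initial value `u₀`: for all `t ∈ [0,T]` and `ξ ∈ V`,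
`(∂ₜu(t), ξ) + (S(Du(t)), Dξ) = (f(t), ξ)`, and `u(0) = u₀`. -/
structure IsSolution {d : ℕ} {Ω : Set (Vec d)} (p δ T : ℝ) (V : Set (Field d Ω))
    (f : ℝ → L2 d Ω) (u₀ : L2 d Ω) (u : ℝ → L2 d Ω) : Prop where
  contDiffOn : ContDiffOn ℝ 1 u (Icc 0 T)
  mem : ∀ t ∈ Icc 0 T, (u t : Field d Ω) ∈ V
  equation : ∀ t ∈ Icc 0 T, ∀ ξ : L2 d Ω, (ξ : Field d Ω) ∈ V →
    inner ℝ (derivWithin u (Icc 0 T) t) ξ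
      + ∫ x in Ω, inner ℝ (stress p δ (symGrad Ω (u t) x)) (symGrad Ω ξ x)
      = inner ℝ (f t) ξ
  initial : u 0 = u₀

end

end GenStokes

/-! Seen as a subspace `V` of `L²(Ω)`, the discretely divergence-free fields are finite-dimensional,
so the semi-discrete problem is an ordinary differential equation `u' = g - A(u)` in a Euclidean
space. Here `g(t)` is the orthogonal projection of `f(t)` onto `V`, and `A` represents the stress
form `ξ ↦ (S(Dv), Dξ)`.

The field `A` is continuous but in general not locally Lipschitz (think of `δ = 0`, `p < 2`), so
Picard-Lindelöf does not apply directly. It is however the gradient of the convex functional `J(v) =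
∫ φ(|Dv|)`, hence monotone. Monotonicity makes the solutions of smoothed problems uniformly Cauchy,
which gives existence (`exists_solution_of_monotone`), and it gives uniqueness as well.

All bounds come from testing with `∂ₜu`, that is, from the gradient-flow inequality `J(u(t)) + ½ ∫₀ᵗ
|u'|² ≤ J(u(0)) + ½ ∫₀ᵗ |g|²` (`energy_le`). The doubling property of `φ'` yields `|F(P)|² ≤ 2^(p+1)
φ(|Pˢʸᵐ|)` (`phiDeriv_mul_le`), so a bound on `J(u(t))` controls `F(Du)` in `L^∞(I, L²)`. The
remaining norms follow by integration in time.

The initial energy is controlled by the `W^{1,p}` norm, uniformly for `δ ≤ 1`; the initial `L²` norm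
by the Sobolev embedding, where `p ≥ 2d/(d+2)` enters (`exists_sobolev_const`). Since `|g| ≤ |f|`,
no constant sees the mesh or the finite element spaces. -/

namespace GenStokes

/-! ### Differential equations with a continuous monotone right-hand side -/

/-- A Gronwall argument: `2K‖e‖ ≤ K² + ‖e‖²` makes `exp(-t)‖e‖² - K² t` nonincreasing. It serves as
an a priori bound, as a stability estimate between approximations and, with `K = 0`, as a uniqueness
proof. -/
theorem norm_sq_le_of_inner_deriv_le {E : Type*} [NormedAddCommGroup E] [InnerProductSpace ℝ E]
    {T K : ℝ} {e e' : ℝ → E}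
    (he : ∀ t ∈ Icc 0 T, HasDerivWithinAt e (e' t) (Icc 0 T) t)
    (hK : ∀ t ∈ Icc 0 T, inner ℝ (e t) (e' t) ≤ K * ‖e t‖) {t : ℝ} (ht : t ∈ Icc 0 T) :
    ‖e t‖ ^ 2 ≤ Real.exp T * (‖e 0‖ ^ 2 + K ^ 2 * T) := by
  have hT : 0 ≤ T := ht.1.trans ht.2
  have hd : ∀ t ∈ Icc 0 T, HasDerivWithinAt (fun t => Real.exp (-t) * ‖e t‖ ^ 2 - K ^ 2 * t)
      (Real.exp (-t) * (-1) * ‖e t‖ ^ 2 + Real.exp (-t) * (2 * inner ℝ (e t) (e' t)) - K ^ 2)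
      (Icc 0 T) t := by
    intro t ht
    have h1 : HasDerivWithinAt (fun t : ℝ => Real.exp (-t)) (Real.exp (-t) * (-1)) (Icc 0 T) t :=
      ((hasDerivAt_neg t).exp).hasDerivWithinAt
    have h2 : HasDerivWithinAt (fun t : ℝ => K ^ 2 * t) (K ^ 2) (Icc 0 T) t := by
      simpa using ((hasDerivAt_id t).const_mul (K ^ 2)).hasDerivWithinAt
    exact (h1.mul (he t ht).norm_sq).sub h2
  have hanti := antitoneOn_of_hasDerivWithinAt_nonpos (convex_Icc 0 T)
    (fun t ht => (hd t ht).continuousWithinAt)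
    (fun t ht => (hd t (interior_subset ht)).mono interior_subset) (fun t ht => ?_)
  · have h := hanti (left_mem_Icc.2 hT) ht ht.1
    simp only [neg_zero, Real.exp_zero, one_mul, mul_zero, sub_zero] at h
    have h1 : Real.exp (-t) * ‖e t‖ ^ 2 ≤ ‖e 0‖ ^ 2 + K ^ 2 * T := by
      nlinarith [mul_le_mul_of_nonneg_left ht.2 (sq_nonneg K)]
    calc ‖e t‖ ^ 2 = Real.exp t * (Real.exp (-t) * ‖e t‖ ^ 2) := by
          rw [← mul_assoc, ← Real.exp_add]; simp
      _ ≤ Real.exp T * (‖e 0‖ ^ 2 + K ^ 2 * T) := by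
          gcongr
          exact ht.2
  · have h1 := hK t (interior_subset ht)
    have h0 : (0 : ℝ) ≤ t := (interior_subset ht).1
    have h2 : Real.exp (-t) ≤ 1 := Real.exp_le_one_iff.2 (by linarith)
    have h3 := Real.exp_pos (-t)
    have h4 : 2 * inner ℝ (e t) (e' t) - ‖e t‖ ^ 2 ≤ K ^ 2 := by nlinarith [sq_nonneg (K - ‖e t‖)]
    have h5 : Real.exp (-t) * (2 * inner ℝ (e t) (e' t) - ‖e t‖ ^ 2) ≤ Real.exp (-t) * K ^ 2 :=
      mul_le_mul_of_nonneg_left h4 h3.le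
    nlinarith [mul_le_mul_of_nonneg_right h2 (sq_nonneg K)]

/-- The speed is at most `G + M`, so a solution stays in the ball of radius `(G + M) T` throughout
`[0, T]`. A `C¹` field is Lipschitz on that compact ball, and one application of Picard-Lindelöf
covers the whole interval. -/
theorem exists_solution_of_contDiff_of_bounded {E : Type*} [NormedAddCommGroup E]
    [NormedSpace ℝ E] [FiniteDimensional ℝ E] {T : ℝ} (hT : 0 ≤ T) {B : E → E}
    (hB : ContDiff ℝ 1 B) {M : ℝ} (hM : ∀ x, ‖B x‖ ≤ M) {g : ℝ → E}
    (hg : ContinuousOn g (Icc 0 T)) (u₀ : E) :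
    ∃ u : ℝ → E, u 0 = u₀ ∧
      ∀ t ∈ Icc 0 T, HasDerivWithinAt u (g t - B (u t)) (Icc 0 T) t := by
  have : ProperSpace E := FiniteDimensional.proper ℝ E
  have hM0 : 0 ≤ M := (norm_nonneg _).trans (hM 0)
  obtain ⟨G, hG⟩ := isCompact_Icc.exists_bound_of_continuousOn hg
  have hG0 : 0 ≤ G := (norm_nonneg _).trans (hG 0 (left_mem_Icc.2 hT))
  have ha : 0 ≤ (G + M) * T := by positivity
  obtain ⟨K, hK⟩ := (hB.locallyLipschitz.locallyLipschitzOn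
    (s := Metric.closedBall u₀ ((G + M) * T))).exists_lipschitzOnWith_of_compact
    (isCompact_closedBall _ _)
  have hPL : IsPicardLindelof (fun t x => g t - B x) (tmin := 0) (tmax := T)
      ⟨0, left_mem_Icc.2 hT⟩ u₀ ⟨(G + M) * T, ha⟩ 0 ⟨G + M, by positivity⟩ K := by
    refine ⟨fun t _ => ?_, fun x _ => hg.sub continuousOn_const, fun t ht x _ => ?_, ?_⟩
    · refine LipschitzOnWith.of_dist_le_mul fun x hx y hy => ?_
      rw [dist_sub_left]
      exact hK.dist_le_mul x hx y hy
    · exact (norm_sub_le _ _).trans (add_le_add (hG t ht) (hM x))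
    · change (G + M) * max (T - 0) (0 - 0) ≤ (G + M) * T - 0
      simp [hT]
  exact hPL.exists_eq_forall_mem_Icc_hasDerivWithinAt₀

/-- `A` is cut off by the radial retraction `π` onto a ball and then approximated uniformly by `C¹`
fields `B n`. An a priori bound makes the cut-off inactive along the solutions `u n`, and
monotonicity bounds `u m - u n` by the approximation errors alone. The sequence thus converges
uniformly without any compactness argument. -/
theorem exists_solution_of_monotone {E : Type*} [NormedAddCommGroup E] [InnerProductSpace ℝ E]
    [FiniteDimensional ℝ E] {T : ℝ} (hT : 0 ≤ T) {A : E → E} (hA : Continuous A) (hA0 : A 0 = 0)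
    (hmono : ∀ v w, 0 ≤ inner ℝ (A v - A w) (v - w)) {g : ℝ → E}
    (hg : ContinuousOn g (Icc 0 T)) (u₀ : E) :
    ∃ u : ℝ → E, u 0 = u₀ ∧
      ∀ t ∈ Icc 0 T, HasDerivWithinAt u (g t - A (u t)) (Icc 0 T) t := by
  have : ProperSpace E := FiniteDimensional.proper ℝ E
  obtain ⟨G, hG⟩ := isCompact_Icc.exists_bound_of_continuousOn hg
  have h0T : (0 : ℝ) ∈ Icc 0 T := left_mem_Icc.2 hT
  have hG0 : 0 ≤ G := (norm_nonneg _).trans (hG 0 h0T)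
  -- The Gronwall bound with `K = G + 1`: `G` from the forcing, `1` from the approximation error.
  -- The final `+ 1` only ensures `R > 0`.
  set R : ℝ := √(Real.exp T * (‖u₀‖ ^ 2 + (G + 1) ^ 2 * T)) + 1 with hR
  have hR0 : 0 < R := by positivity
  let π : E → E := fun x => (R / max R ‖x‖) • x
  have hmax : ∀ x : E, 0 < max R ‖x‖ := fun x => lt_max_of_lt_left hR0
  have hπc : Continuous π :=
    (continuous_const.div (continuous_const.max continuous_norm) fun x => (hmax x).ne').smul
      continuous_id
  have hπid : ∀ x, ‖x‖ ≤ R → π x = x := fun x hx => by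
    simp only [π, max_eq_left hx, div_self hR0.ne', one_smul]
  have hπR : ∀ x, π x ∈ Metric.closedBall (0 : E) R := fun x => by
    rw [mem_closedBall_zero_iff]
    simp only [π, norm_smul, norm_div, Real.norm_eq_abs, abs_of_pos hR0, abs_of_pos (hmax x)]
    rw [div_mul_eq_mul_div, div_le_iff₀ (hmax x)]
    exact mul_le_mul_of_nonneg_left (le_max_right _ _) hR0.le
  obtain ⟨M, hM⟩ := (isCompact_closedBall (0 : E) R).exists_bound_of_continuousOn hA.continuousOn
  -- `π x` is a positive multiple of `x`, so the cut-off field keeps the sign condition that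
  -- monotonicity against `0` gives for `A`.
  have hπA : ∀ x, 0 ≤ inner ℝ (A (π x)) x := fun x => by
    have h := hmono (π x) 0
    simp only [hA0, sub_zero] at h
    rw [show π x = (R / max R ‖x‖) • x from rfl, inner_smul_right] at h
    exact nonneg_of_mul_nonneg_right h (div_pos hR0 (hmax x))
  have hε : ∀ n : ℕ, (0 : ℝ) < 1 / (n + 1) := fun n => by positivity
  have hε1 : ∀ n : ℕ, (1 : ℝ) / (n + 1) ≤ 1 := fun n => by
    rw [div_le_one (by positivity)]
    linarith [(Nat.cast_nonneg n : (0 : ℝ) ≤ n)]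
  choose B hBs hBd _ using fun n : ℕ => (hA.comp hπc).exists_contDiff_approx 1
    (ε := fun _ => 1 / ((n : ℝ) + 1)) continuous_const fun _ => hε n
  have hBd' : ∀ n x, ‖B n x - A (π x)‖ ≤ 1 / ((n : ℝ) + 1) := fun n x => by
    rw [← dist_eq_norm]
    exact (hBd n x).le
  have hBM : ∀ n x, ‖B n x‖ ≤ M + 1 := fun n x => by
    have h1 := norm_le_norm_add_norm_sub' (B n x) (A (π x))
    linarith [hM _ (hπR x), hBd' n x, hε1 n]
  choose u hu0 hu using fun n =>
    exists_solution_of_contDiff_of_bounded hT (hBs n) (hBM n) hg u₀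
  have huR : ∀ n, ∀ t ∈ Icc 0 T, ‖u n t‖ ≤ R := fun n t ht => by
    have h := norm_sq_le_of_inner_deriv_le (hu n) (K := G + 1) (fun s hs => ?_) ht
    · rw [hu0] at h
      have := Real.le_sqrt_of_sq_le h
      linarith
    · have h1 : inner ℝ (u n s) (g s - B n (u n s))
          = inner ℝ (u n s) (g s) - inner ℝ (u n s) (B n (u n s) - A (π (u n s)))
            - inner ℝ (A (π (u n s))) (u n s) := by
        rw [real_inner_comm (u n s) (A (π (u n s))), ← inner_sub_right, ← inner_sub_right]
        congr 1
        abel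
      have h2 := real_inner_le_norm (u n s) (g s)
      have h3 := neg_le_of_abs_le (abs_real_inner_le_norm (u n s) (B n (u n s) - A (π (u n s))))
      have h4 := mul_le_mul_of_nonneg_left (hG s hs) (norm_nonneg (u n s))
      have h5 := mul_le_mul_of_nonneg_left ((hBd' n (u n s)).trans (hε1 n)) (norm_nonneg (u n s))
      linarith [hπA (u n s)]
  have hBA : ∀ n, ∀ t ∈ Icc 0 T, ‖B n (u n t) - A (u n t)‖ ≤ 1 / ((n : ℝ) + 1) := fun n t ht => by
    have h := hBd' n (u n t)
    rwa [hπid _ (huR n t ht)] at h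
  have hdiff : ∀ m n, ∀ t ∈ Icc 0 T, ‖u m t - u n t‖ ^ 2
      ≤ Real.exp T * ((1 / ((m : ℝ) + 1) + 1 / ((n : ℝ) + 1)) ^ 2 * T) := fun m n t ht => by
    have h := norm_sq_le_of_inner_deriv_le (e := fun t => u m t - u n t)
      (fun s hs => (hu m s hs).sub (hu n s hs))
      (K := 1 / ((m : ℝ) + 1) + 1 / ((n : ℝ) + 1)) (fun s hs => ?_) ht
    · simpa [hu0] using h
    · have h1 : inner ℝ (u m s - u n s) (g s - B m (u m s) - (g s - B n (u n s)))
          = inner ℝ (u m s - u n s) (B n (u n s) - A (u n s))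
            - inner ℝ (u m s - u n s) (B m (u m s) - A (u m s))
            - inner ℝ (A (u m s) - A (u n s)) (u m s - u n s) := by
        rw [real_inner_comm (u m s - u n s) (A (u m s) - A (u n s)), ← inner_sub_right,
          ← inner_sub_right]
        congr 1
        abel
      have h2 := real_inner_le_norm (u m s - u n s) (B n (u n s) - A (u n s))
      have h3 := neg_le_of_abs_le
        (abs_real_inner_le_norm (u m s - u n s) (B m (u m s) - A (u m s)))
      have h4 := mul_le_mul_of_nonneg_left (hBA m s hs) (norm_nonneg (u m s - u n s))
      have h5 := mul_le_mul_of_nonneg_left (hBA n s hs) (norm_nonneg (u m s - u n s))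
      linarith [hmono (u m s) (u n s)]
  have hcauchy : UniformCauchySeqOn u atTop (Icc 0 T) := by
    rw [Metric.uniformCauchySeqOn_iff]
    intro ε hε0
    have hlim : Tendsto (fun n : ℕ => Real.exp T * ((1 / ((n : ℝ) + 1) + 1 / ((n : ℝ) + 1)) ^ 2 * T))
        atTop (𝓝 0) := by
      have h1 := tendsto_one_div_add_atTop_nhds_zero_nat (𝕜 := ℝ)
      simpa using (((h1.add h1).pow 2).mul_const T).const_mul (Real.exp T)
    obtain ⟨N, hN⟩ := (hlim.eventually_lt_const (pow_pos hε0 2)).exists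
    refine ⟨N, fun m hm n hn t ht => ?_⟩
    rw [dist_eq_norm]
    refine lt_of_pow_lt_pow_left₀ 2 hε0.le (lt_of_le_of_lt ((hdiff m n t ht).trans ?_) hN)
    gcongr
  have hlimex : ∀ t ∈ Icc 0 T, ∃ x, Tendsto (fun n => u n t) atTop (𝓝 x) := fun t ht =>
    cauchySeq_tendsto_of_complete (hcauchy.cauchySeq ht)
  choose! v hv using hlimex
  have hunif := hcauchy.tendstoUniformlyOn_of_tendsto hv
  have hvc : ContinuousOn v (Icc 0 T) := hunif.continuousOn
    (Frequently.of_forall fun n t ht => (hu n t ht).continuousWithinAt)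
  -- The limit is taken in the integrated equation, by dominated convergence; the limit is
  -- continuous, so the fundamental theorem of calculus recovers its derivative.
  have hpic : ∀ t ∈ Icc 0 T, v t = ODE.picard (fun t x => g t - A x) 0 u₀ v t := by
    intro t ht
    have hsub : uIcc 0 t ⊆ Icc 0 T := uIcc_subset_Icc h0T ht
    have hsub' : uIoc 0 t ⊆ Icc 0 T := uIoc_subset_uIcc.trans hsub
    have hcont : ∀ n, ContinuousOn (fun s => g s - B n (u n s)) (Icc 0 T) := fun n =>
      hg.sub ((hBs n).continuous.comp_continuousOn fun s hs => (hu n s hs).continuousWithinAt)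
    have hun : ∀ n, u n t = u₀ + ∫ s in 0..t, (g s - B n (u n s)) := fun n => by
      rw [intervalIntegral.integral_eq_sub_of_hasDeriv_right (f := u n)
        (fun s hs => ((hu n s (hsub hs)).mono hsub).continuousWithinAt) (fun s hs => ?_)
        (((hcont n).mono hsub).intervalIntegrable), hu0]
      · abel
      · rw [min_eq_left ht.1, max_eq_right ht.1] at hs
        refine ((hu n s ⟨hs.1.le, hs.2.le.trans ht.2⟩).mono_of_mem_nhdsWithin ?_)
        exact mem_nhdsWithin_of_mem_nhds (Icc_mem_nhds hs.1 (hs.2.trans_le ht.2))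
    have hint : Tendsto (fun n => ∫ s in 0..t, (g s - B n (u n s))) atTop
        (𝓝 (∫ s in 0..t, (g s - A (v s)))) := by
      refine intervalIntegral.tendsto_integral_filter_of_dominated_convergence
        (fun _ => G + (M + 1)) (.of_forall fun n => ?_) (.of_forall fun n => .of_forall fun s hs => ?_)
        intervalIntegrable_const (.of_forall fun s hs => ?_)
      · exact ((hcont n).mono hsub').aestronglyMeasurable measurableSet_uIoc
      · exact (norm_sub_le _ _).trans (add_le_add (hG s (hsub' hs)) (hBM n _))
      · refine tendsto_const_nhds.sub ?_
        have h1 : Tendsto (fun n => A (u n s)) atTop (𝓝 (A (v s))) :=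
          (hA.tendsto _).comp (hv s (hsub' hs))
        have h2 : Tendsto (fun n => B n (u n s) - A (u n s)) atTop (𝓝 0) :=
          squeeze_zero_norm (fun n => hBA n s (hsub' hs)) tendsto_one_div_add_atTop_nhds_zero_nat
        simpa using h2.add h1
    refine tendsto_nhds_unique (hv t ht) ?_
    simp only [hun]
    exact tendsto_const_nhds.add hint
  have hfc : ContinuousOn (Function.uncurry fun t x => g t - A x) (Icc 0 T ×ˢ univ) :=
    (hg.comp continuousOn_fst fun x hx => hx.1).sub (hA.comp_continuousOn continuousOn_snd)
  refine ⟨v, ?_, fun t ht => ?_⟩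
  · rw [hpic 0 h0T, ODE.picard_apply₀]
  · exact (ODE.hasDerivWithinAt_picard_Icc h0T hfc hvc (fun _ _ => mem_univ _) u₀ ht).congr hpic
      (hpic t ht)

/-! ### Gradient flows -/

/-- `J v - J w` lies between `(A w, v - w)` and `(A v, v - w)`, and these differ by `o(‖v - w‖)`
because `A` is continuous. The energy is thus differentiable with no differentiation under the
integral sign. -/
theorem hasFDerivAt_of_subgradient {E : Type*} [NormedAddCommGroup E] [InnerProductSpace ℝ E]
    {A : E → E} (hA : Continuous A) {J : E → ℝ}
    (hJ : ∀ v w, inner ℝ (A w) (v - w) ≤ J v - J w) (w : E) :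
    HasFDerivAt J (innerSL ℝ (A w)) w := by
  rw [hasFDerivAt_iff_isLittleO, Asymptotics.isLittleO_iff]
  intro c hc
  obtain ⟨r, hr, hr'⟩ := Metric.continuousAt_iff.1 (hA.continuousAt (x := w)) c hc
  filter_upwards [Metric.ball_mem_nhds w hr] with v hv
  have h1 := hJ v w
  have h2 := hJ w v
  have h3 : inner ℝ (A v) (w - v) = -inner ℝ (A v) (v - w) := by
    rw [← inner_neg_right, neg_sub]
  have h4 : inner ℝ (A v - A w) (v - w) ≤ c * ‖v - w‖ :=
    (real_inner_le_norm _ _).trans (mul_le_mul_of_nonneg_right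
      (by rw [← dist_eq_norm]; exact (hr' hv).le) (norm_nonneg _))
  rw [inner_sub_left] at h4
  rw [innerSL_apply_apply, Real.norm_eq_abs, abs_le]
  constructor <;> nlinarith [mul_nonneg hc.le (norm_nonneg (v - w))]

/-- With `u' = g - A u`, expanding `‖g‖² = ‖u' + A u‖²` gives `(A u, u') + (‖u'‖² - ‖g‖²)/2 = -‖A
u‖²/2 ≤ 0`. The left side is the time derivative of the difference of the two sides. -/
theorem energy_le {E : Type*} [NormedAddCommGroup E] [InnerProductSpace ℝ E]
    {A : E → E} (hA : Continuous A) {J : E → ℝ}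
    (hJ : ∀ v w, inner ℝ (A w) (v - w) ≤ J v - J w) {T : ℝ} {g u : ℝ → E}
    (hg : ContinuousOn g (Icc 0 T))
    (hu : ∀ t ∈ Icc 0 T, HasDerivWithinAt u (g t - A (u t)) (Icc 0 T) t) {t : ℝ}
    (ht : t ∈ Icc 0 T) :
    J (u t) + (∫ s in 0..t, ‖g s - A (u s)‖ ^ 2) / 2 ≤ J (u 0) + (∫ s in 0..t, ‖g s‖ ^ 2) / 2 := by
  have hT : 0 ≤ T := ht.1.trans ht.2
  have huc : ContinuousOn u (Icc 0 T) := fun s hs => (hu s hs).continuousWithinAt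
  have hq : ContinuousOn (fun s => (‖g s - A (u s)‖ ^ 2 - ‖g s‖ ^ 2) / 2) (Icc 0 T) :=
    ((((hg.sub (hA.comp_continuousOn huc)).norm).pow 2).sub (hg.norm.pow 2)).div_const 2
  have hd : ∀ s ∈ Icc 0 T, HasDerivWithinAt
      (fun s => J (u s) + ∫ r in 0..s, (‖g r - A (u r)‖ ^ 2 - ‖g r‖ ^ 2) / 2)
      (inner ℝ (A (u s)) (g s - A (u s)) + (‖g s - A (u s)‖ ^ 2 - ‖g s‖ ^ 2) / 2) (Icc 0 T) s := by
    intro s hs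
    refine ((hasFDerivAt_of_subgradient hA hJ (u s)).comp_hasDerivWithinAt s (hu s hs)).add ?_
    have : Fact (s ∈ Icc 0 T) := ⟨hs⟩
    exact intervalIntegral.integral_hasDerivWithinAt_right
      ((hq.mono (uIcc_subset_Icc (left_mem_Icc.2 hT) hs)).intervalIntegrable)
      (hq.stronglyMeasurableAtFilter_nhdsWithin measurableSet_Icc s) (hq s hs)
  have hanti := antitoneOn_of_hasDerivWithinAt_nonpos (convex_Icc 0 T)
    (fun t ht => (hd t ht).continuousWithinAt)
    (fun t ht => (hd t (interior_subset ht)).mono interior_subset) (fun s _ => ?_)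
  · have h := hanti (left_mem_Icc.2 hT) ht ht.1
    have hsub : uIcc 0 t ⊆ Icc 0 T := uIcc_subset_Icc (left_mem_Icc.2 hT) ht
    have i1 : IntervalIntegrable (fun s => ‖g s - A (u s)‖ ^ 2) volume 0 t :=
      ((((hg.sub (hA.comp_continuousOn huc)).norm).pow 2).mono hsub).intervalIntegrable
    have i2 : IntervalIntegrable (fun s => ‖g s‖ ^ 2) volume 0 t :=
      ((hg.norm.pow 2).mono hsub).intervalIntegrable
    simp only [intervalIntegral.integral_same, add_zero, intervalIntegral.integral_div,
      intervalIntegral.integral_sub i1 i2] at h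
    linarith
  · have h1 : ‖g s‖ ^ 2 = ‖g s - A (u s)‖ ^ 2 + 2 * inner ℝ (A (u s)) (g s - A (u s))
        + ‖A (u s)‖ ^ 2 := by
      rw [real_inner_comm, ← norm_add_sq_real, sub_add_cancel]
    nlinarith [sq_nonneg ‖A (u s)‖]

/-! ### The `N`-function and the extra stress -/

/-- The only delicate point is `r = 0` with `δ = 0`, where the power is singular for `p < 2`; the
factor `|r|` turns it into `|r|^(p-1)`. The even extension lets `phi` be integrated over arbitrary
real intervals. -/
theorem continuous_phiDeriv_abs {p δ : ℝ} (hp : 1 < p) (hδ : 0 ≤ δ) :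
    Continuous fun r : ℝ => phiDeriv p δ |r| := by
  rcases hδ.eq_or_lt with rfl | hδ
  · have h : (fun r : ℝ => phiDeriv p 0 |r|) = fun r => |r| ^ (p - 1) := by
      ext r
      rcases (abs_nonneg r).eq_or_lt with h | h
      · rw [phiDeriv, ← h, mul_zero, Real.zero_rpow (by linarith)]
      · rw [phiDeriv, zero_add, ← Real.rpow_add_one h.ne']
        congr 1
        ring
    rw [h]
    exact continuous_abs.rpow_const fun _ => Or.inr (by linarith)
  · exact ((continuous_const.add continuous_abs).rpow_const fun x => Or.inl
      (add_pos_of_pos_of_nonneg hδ (abs_nonneg x)).ne').mul continuous_abs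

theorem phiDeriv_nonneg {p δ s : ℝ} (hδ : 0 ≤ δ) (hs : 0 ≤ s) : 0 ≤ phiDeriv p δ s :=
  mul_nonneg (Real.rpow_nonneg (by positivity) _) hs

theorem phiDeriv_zero (p δ : ℝ) : phiDeriv p δ 0 = 0 := by simp [phiDeriv]

/-- Both factors on the right are nondecreasing in `s` whatever the sign of `p - 2`, so monotonicity
and doubling need no case distinction at `p = 2`. -/
theorem phiDeriv_eq {p δ s : ℝ} (hδ : 0 ≤ δ) (hs : 0 < s) :
    phiDeriv p δ s = (δ + s) ^ (p - 1) * (s / (δ + s)) := by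
  have h : 0 < δ + s := by positivity
  have h1 : (δ + s) ^ (p - 1) = (δ + s) ^ (p - 2) * (δ + s) := by
    rw [← Real.rpow_add_one h.ne']
    congr 1
    ring
  rw [phiDeriv, h1]
  field_simp

theorem phiDeriv_le {p δ s : ℝ} (hδ : 0 ≤ δ) (hs : 0 ≤ s) :
    phiDeriv p δ s ≤ (δ + s) ^ (p - 1) := by
  rcases hs.eq_or_lt with rfl | hs
  · rw [phiDeriv_zero]
    positivity
  · rw [phiDeriv_eq hδ hs]
    refine mul_le_of_le_one_right (by positivity) ?_
    rw [div_le_one (by positivity)]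
    linarith

theorem phiDeriv_monotoneOn {p δ : ℝ} (hp : 1 < p) (hδ : 0 ≤ δ) :
    MonotoneOn (phiDeriv p δ) (Ici 0) := by
  intro a ha b hb hab
  rcases (mem_Ici.1 ha).eq_or_lt with rfl | ha
  · rw [phiDeriv_zero]
    exact phiDeriv_nonneg hδ hb
  · have hb : 0 < b := ha.trans_le hab
    rw [phiDeriv_eq hδ ha, phiDeriv_eq hδ hb]
    refine mul_le_mul (Real.rpow_le_rpow (by positivity) (by linarith) (by linarith)) ?_
      (by positivity) (by positivity)
    rw [div_le_div_iff₀ (by positivity) (by positivity)]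
    nlinarith

/-- The doubling condition, uniform in `δ`: the power factor costs `2^(p-1)` and the quotient costs
`2`. -/
theorem phiDeriv_half {p δ s : ℝ} (hp : 1 < p) (hδ : 0 ≤ δ) (hs : 0 ≤ s) :
    phiDeriv p δ s ≤ 2 ^ p * phiDeriv p δ (s / 2) := by
  rcases hs.eq_or_lt with rfl | hs
  · simp [phiDeriv_zero]
  · rw [phiDeriv_eq hδ hs, phiDeriv_eq hδ (half_pos hs)]
    have h1 : (δ + s) ^ (p - 1) ≤ 2 ^ (p - 1) * (δ + s / 2) ^ (p - 1) := by
      rw [← Real.mul_rpow (by norm_num) (by positivity)]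
      exact Real.rpow_le_rpow (by positivity) (by linarith) (by linarith)
    have h2 : s / (δ + s) ≤ 2 * ((s / 2) / (δ + s / 2)) := by
      rw [← mul_div_assoc, mul_div_cancel₀ s two_ne_zero]
      exact div_le_div_of_nonneg_left hs.le (by positivity) (by linarith)
    have h3 : (2 : ℝ) ^ p = 2 ^ (p - 1) * 2 := by
      rw [← Real.rpow_add_one two_ne_zero]
      congr 1
      ring
    calc (δ + s) ^ (p - 1) * (s / (δ + s))
        ≤ (2 ^ (p - 1) * (δ + s / 2) ^ (p - 1)) * (2 * ((s / 2) / (δ + s / 2))) :=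
          mul_le_mul h1 h2 (by positivity) (by positivity)
      _ = 2 ^ p * ((δ + s / 2) ^ (p - 1) * (s / 2 / (δ + s / 2))) := by rw [h3]; ring

/-- The `N`-function `φ` with `(p, δ)`-structure. -/
noncomputable def phi (p δ s : ℝ) : ℝ := ∫ r in 0..s, phiDeriv p δ |r|

theorem continuous_phi {p δ : ℝ} (hp : 1 < p) (hδ : 0 ≤ δ) : Continuous (phi p δ) :=
  intervalIntegral.continuous_primitive
    (fun _ _ => (continuous_phiDeriv_abs hp hδ).intervalIntegrable _ _) 0

theorem phi_sub_phi {p δ : ℝ} (hp : 1 < p) (hδ : 0 ≤ δ) (a b : ℝ) :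
    phi p δ b - phi p δ a = ∫ r in a..b, phiDeriv p δ |r| :=
  intervalIntegral.integral_interval_sub_left
    ((continuous_phiDeriv_abs hp hδ).intervalIntegrable _ _)
    ((continuous_phiDeriv_abs hp hδ).intervalIntegrable _ _)

theorem phi_zero (p δ : ℝ) : phi p δ 0 = 0 := by simp [phi]

/-- Convexity of `φ` on `[0, ∞)`: its derivative is nondecreasing, so the graph lies above its
tangents. -/
theorem phiDeriv_mul_sub_le {p δ a b : ℝ} (hp : 1 < p) (hδ : 0 ≤ δ) (ha : 0 ≤ a) (hb : 0 ≤ b) :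
    phiDeriv p δ a * (b - a) ≤ phi p δ b - phi p δ a := by
  have hc := continuous_phiDeriv_abs hp hδ
  rcases le_total a b with hab | hab
  · rw [phi_sub_phi hp hδ]
    have h := intervalIntegral.integral_mono_on (μ := volume) hab
      (intervalIntegrable_const (c := phiDeriv p δ a))
      (hc.intervalIntegrable a b) fun r hr => ?_
    · simpa [mul_comm] using h
    · rw [abs_of_nonneg (ha.trans hr.1)]
      exact phiDeriv_monotoneOn hp hδ ha (ha.trans hr.1) hr.1
  · have h := intervalIntegral.integral_mono_on (μ := volume) hab
      (hc.intervalIntegrable b a) (intervalIntegrable_const (c := phiDeriv p δ a)) fun r hr => ?_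
    · rw [← phi_sub_phi hp hδ] at h
      simp only [intervalIntegral.integral_const, smul_eq_mul] at h
      linarith
    · rw [abs_of_nonneg (hb.trans hr.1)]
      exact phiDeriv_monotoneOn hp hδ (hb.trans hr.1) ha hr.2

theorem phi_nonneg {p δ s : ℝ} (hp : 1 < p) (hδ : 0 ≤ δ) (hs : 0 ≤ s) : 0 ≤ phi p δ s := by
  have h := phiDeriv_mul_sub_le hp hδ le_rfl hs
  simpa [phi_zero, phiDeriv_zero] using h

theorem phi_le {p δ s : ℝ} (hp : 1 < p) (hδ : 0 ≤ δ) (hs : 0 ≤ s) :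
    phi p δ s ≤ phiDeriv p δ s * s := by
  have h := phiDeriv_mul_sub_le hp hδ hs le_rfl
  rw [phi_zero] at h
  linarith

/-- The tangent at `s/2` gives `φ'(s/2) s/2 ≤ φ(s)`, and doubling replaces `φ'(s/2)` by `φ'(s)`.
Since `|F(P)|² = φ'(|Pˢʸᵐ|)|Pˢʸᵐ|`, this bounds `F` by the energy density. -/
theorem phiDeriv_mul_le {p δ s : ℝ} (hp : 1 < p) (hδ : 0 ≤ δ) (hs : 0 ≤ s) :
    phiDeriv p δ s * s ≤ 2 ^ (p + 1) * phi p δ s := by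
  have h0 : 0 ≤ s / 2 := by positivity
  have h1 := phiDeriv_mul_sub_le hp hδ h0 hs
  have h2 := phi_nonneg hp hδ h0
  have h3 := mul_le_mul_of_nonneg_right (phiDeriv_half hp hδ hs) hs
  have h4 : phiDeriv p δ (s / 2) * s ≤ 2 * phi p δ s := by linarith
  rw [Real.rpow_add_one two_ne_zero]
  have h5 := mul_le_mul_of_nonneg_left h4 (Real.rpow_nonneg zero_le_two p)
  linarith

/-- The restriction `δ ≤ 1` makes the growth bound, and hence the final constant, independent of
`δ`. -/
theorem phiDeriv_mul_le_rpow {p δ s : ℝ} (hδ : 0 ≤ δ) (hδ1 : δ ≤ 1) (hp : 1 < p) (hs : 0 ≤ s) :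
    phiDeriv p δ s * s ≤ (1 + s) ^ p := by
  have h0 : 0 < 1 + s := by positivity
  calc phiDeriv p δ s * s ≤ (1 + s) ^ (p - 1) * (1 + s) :=
        mul_le_mul ((phiDeriv_le hδ hs).trans
          (Real.rpow_le_rpow (by positivity) (by linarith) (by linarith))) (by linarith) hs
          (by positivity)
    _ = (1 + s) ^ p := by
        rw [← Real.rpow_add_one h0.ne']
        congr 1
        ring

theorem symPart_add {d : ℕ} (A B : Tensor d) : symPart (A + B) = symPart A + symPart B := by
  ext ij
  simp [symPart]
  ring

theorem symPart_smul {d : ℕ} (c : ℝ) (A : Tensor d) : symPart (c • A) = c • symPart A := by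
  ext ij
  simp [symPart]
  ring

/-- The symmetric part as a linear map. -/
noncomputable def symPartL (d : ℕ) : Tensor d →ₗ[ℝ] Tensor d where
  toFun := symPart
  map_add' := symPart_add
  map_smul' := symPart_smul

theorem symPart_symPart {d : ℕ} (A : Tensor d) : symPart (symPart A) = symPart A := by
  ext ij
  simp [symPart]
  ring

theorem continuous_symPart (d : ℕ) : Continuous (symPart : Tensor d → Tensor d) :=
  (symPartL d).continuous_of_finiteDimensional

theorem norm_symPart_le {d : ℕ} (A : Tensor d) : ‖symPart A‖ ≤ ‖A‖ := by
  let B : Tensor d := WithLp.toLp 2 fun ij => A (ij.2, ij.1)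
  have hB : ‖B‖ = ‖A‖ := by
    rw [EuclideanSpace.norm_eq, EuclideanSpace.norm_eq]
    congr 1
    exact Fintype.sum_equiv (Equiv.prodComm _ _) _ _ fun ij => rfl
  have h : symPart A = (1 / 2 : ℝ) • (A + B) := by
    ext ij
    simp [symPart, B]
    ring
  rw [h, norm_smul]
  have := norm_add_le A B
  rw [hB] at this
  norm_num
  linarith

theorem stress_symPart {d : ℕ} (p δ : ℝ) (P : Tensor d) :
    stress p δ (symPart P) = stress p δ P := by
  rw [stress, symPart_symPart, ← stress]

theorem norm_stress {d : ℕ} {p δ : ℝ} (hδ : 0 ≤ δ) (P : Tensor d) :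
    ‖stress p δ P‖ = phiDeriv p δ ‖symPart P‖ := by
  rw [stress, norm_smul, norm_div, norm_norm,
    Real.norm_of_nonneg (phiDeriv_nonneg hδ (norm_nonneg _))]
  rcases eq_or_ne ‖symPart P‖ 0 with h | h
  · rw [h, phiDeriv_zero, mul_zero]
  · rw [div_mul_cancel₀ _ h]

theorem continuous_stress {d : ℕ} {p δ : ℝ} (hp : 1 < p) (hδ : 0 ≤ δ) :
    Continuous (stress p δ : Tensor d → Tensor d) := by
  have h1 : Continuous fun P : Tensor d => phiDeriv p δ ‖symPart P‖ := by
    simpa [Function.comp_def] using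
      (continuous_phiDeriv_abs hp hδ).comp (continuous_symPart d).norm
  rw [continuous_iff_continuousAt]
  intro P
  rcases eq_or_ne (symPart P) 0 with h | h
  · have h0 : stress p δ P = 0 := by simp [stress, h]
    rw [ContinuousAt, h0, tendsto_zero_iff_norm_tendsto_zero]
    simp only [norm_stress hδ]
    have h2 := h1.tendsto P
    rwa [h, norm_zero, phiDeriv_zero] at h2
  · exact (h1.continuousAt.div (continuous_symPart d).norm.continuousAt
      (norm_ne_zero_iff.2 h)).smul (continuous_symPart d).continuousAt

/-- `F` has the structure of a stress with exponent `p/2 + 1 > 1`, so it inherits continuity. -/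
theorem natF_eq_stress {d : ℕ} (p δ : ℝ) (P : Tensor d) : natF p δ P = stress (p / 2 + 1) δ P := by
  rw [natF, stress, phiDeriv]
  rcases eq_or_ne ‖symPart P‖ 0 with h | h
  · rw [norm_eq_zero.1 h, smul_zero, smul_zero]
  · rw [mul_div_cancel_right₀ _ h]
    congr 2
    ring

theorem continuous_natF {d : ℕ} {p δ : ℝ} (hp : 1 < p) (hδ : 0 ≤ δ) :
    Continuous (natF p δ : Tensor d → Tensor d) := by
  simp only [funext (natF_eq_stress p δ)]
  exact continuous_stress (by linarith) hδ

theorem norm_natF_sq {d : ℕ} {p δ : ℝ} (hδ : 0 ≤ δ) (P : Tensor d) :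
    ‖natF p δ P‖ ^ 2 = phiDeriv p δ ‖symPart P‖ * ‖symPart P‖ := by
  have h : 0 ≤ δ + ‖symPart P‖ := by positivity
  rw [natF, norm_smul, Real.norm_of_nonneg (Real.rpow_nonneg h _), mul_pow, ← Real.rpow_natCast,
    ← Real.rpow_mul h, phiDeriv]
  norm_num
  ring

/-- The stress is a subgradient of `P ↦ φ(|Pˢʸᵐ|)`: Cauchy-Schwarz reduces the claim to the scalar
tangent inequality for `φ`. -/
theorem inner_stress_sub_le {d : ℕ} {p δ : ℝ} (hp : 1 < p) (hδ : 0 ≤ δ) (P Q : Tensor d) :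
    inner ℝ (stress p δ Q) (symPart P - symPart Q)
      ≤ phi p δ ‖symPart P‖ - phi p δ ‖symPart Q‖ := by
  refine le_trans ?_ (phiDeriv_mul_sub_le hp hδ (norm_nonneg (symPart Q)) (norm_nonneg (symPart P)))
  rw [stress, real_inner_smul_left, inner_sub_right, real_inner_self_eq_norm_sq]
  rcases (norm_nonneg (symPart Q)).eq_or_lt with h | h
  · rw [← h, phiDeriv_zero]
    simp
  · have h1 := real_inner_le_norm (symPart Q) (symPart P)
    have h2 : 0 ≤ phiDeriv p δ ‖symPart Q‖ / ‖symPart Q‖ :=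
      div_nonneg (phiDeriv_nonneg hδ h.le) h.le
    calc phiDeriv p δ ‖symPart Q‖ / ‖symPart Q‖ * (inner ℝ (symPart Q) (symPart P) - ‖symPart Q‖ ^ 2)
        ≤ phiDeriv p δ ‖symPart Q‖ / ‖symPart Q‖
          * (‖symPart Q‖ * ‖symPart P‖ - ‖symPart Q‖ ^ 2) :=
          mul_le_mul_of_nonneg_left (by linarith) h2
      _ = phiDeriv p δ ‖symPart Q‖ * (‖symPart P‖ - ‖symPart Q‖) := by
          field_simp

/-! ### Integral functionals on finite-dimensional spaces of tensor fields -/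

theorem integrable_one_add_mul_rpow {α : Type*} [MeasurableSpace α] {μ : Measure α}
    [IsFiniteMeasure μ] {p : ℝ} (hp : 1 < p) {m : α → ℝ} (hm : MemLp m (ENNReal.ofReal p) μ)
    (hm0 : ∀ x, 0 ≤ m x) {R : ℝ} (hR : 0 ≤ R) : Integrable (fun x => (1 + R * m x) ^ p) μ := by
  have h0 : MemLp (fun x => R * m x) (ENNReal.ofReal p) μ := hm.const_mul R
  have h1 : MemLp (fun x => 1 + R * m x) (ENNReal.ofReal p) μ := (memLp_const (1 : ℝ)).add h0
  have h2 := h1.integrable_norm_rpow (by simpa using by linarith) ENNReal.ofReal_ne_top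
  rw [ENNReal.toReal_ofReal (by linarith)] at h2
  refine h2.congr (.of_forall fun x => ?_)
  have : 0 ≤ 1 + R * m x := by have := mul_nonneg hR (hm0 x); linarith
  simp only [Real.norm_of_nonneg this]

section

-- `L x v` models `Dv(x)`, exactly linear in `v` at every point, with an envelope `m ∈ L^p`. On
-- bounded sets of `v` all integrands below are dominated by a multiple of `(1 + R m)^p`.
variable {d : ℕ} {α : Type*} {V : Type*} [NormedAddCommGroup V] [InnerProductSpace ℝ V]
  {p δ : ℝ} {L : α → V →ₗ[ℝ] Tensor d} {m : α → ℝ}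

theorem one_add_norm_rpow_le (hp : 1 < p) (hm0 : ∀ x, 0 ≤ m x)
    (hL : ∀ x v, ‖L x v‖ ≤ m x * ‖v‖) {v : V} {R : ℝ} (hv : ‖v‖ ≤ R) (x : α) :
    (1 + ‖symPart (L x v)‖) ^ p ≤ (1 + R * m x) ^ p := by
  refine Real.rpow_le_rpow (by positivity) ?_ (by linarith)
  have h1 := (norm_symPart_le _).trans (hL x v)
  have h2 := mul_le_mul_of_nonneg_left hv (hm0 x)
  linarith

theorem phi_integrand_le (hp : 1 < p) (hδ : 0 ≤ δ) (hδ1 : δ ≤ 1) (P : Tensor d) :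
    phi p δ ‖symPart P‖ ≤ (1 + ‖symPart P‖) ^ p :=
  (phi_le hp hδ (norm_nonneg _)).trans (phiDeriv_mul_le_rpow hδ hδ1 hp (norm_nonneg _))

theorem natF_sq_le (hp : 1 < p) (hδ : 0 ≤ δ) (hδ1 : δ ≤ 1) (P : Tensor d) :
    ‖natF p δ P‖ ^ 2 ≤ (1 + ‖symPart P‖) ^ p :=
  (norm_natF_sq hδ P).trans_le (phiDeriv_mul_le_rpow hδ hδ1 hp (norm_nonneg _))

theorem abs_inner_stress_le (hp : 1 < p) (hδ : 0 ≤ δ) (hδ1 : δ ≤ 1) (hm0 : ∀ x, 0 ≤ m x)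
    (hL : ∀ x v, ‖L x v‖ ≤ m x * ‖v‖) {v ξ : V} {R : ℝ} (hv : ‖v‖ ≤ R) (hξ : ‖ξ‖ ≤ R) (x : α) :
    ‖(inner ℝ (stress p δ (L x v)) (L x ξ) : ℝ)‖ ≤ (1 + R * m x) ^ p := by
  have hR : 0 ≤ R := (norm_nonneg v).trans hv
  have h0 : 0 < 1 + R * m x := by have := mul_nonneg hR (hm0 x); linarith
  have h1 := (norm_symPart_le _).trans (hL x v)
  have h2 := mul_le_mul_of_nonneg_left hv (hm0 x)
  have h3 := hL x ξ
  have h4 := mul_le_mul_of_nonneg_left hξ (hm0 x)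
  calc ‖(inner ℝ (stress p δ (L x v)) (L x ξ) : ℝ)‖ ≤ ‖stress p δ (L x v)‖ * ‖L x ξ‖ :=
        norm_inner_le_norm _ _
    _ ≤ (1 + R * m x) ^ (p - 1) * (1 + R * m x) := by
        refine mul_le_mul ?_ (by linarith) (norm_nonneg _) (by positivity)
        rw [norm_stress hδ]
        exact (phiDeriv_le hδ (norm_nonneg _)).trans
          (Real.rpow_le_rpow (by positivity) (by linarith) (by linarith))
    _ = (1 + R * m x) ^ p := by
        rw [← Real.rpow_add_one h0.ne']
        congr 1
        ring


variable [MeasurableSpace α] {μ : Measure α}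

theorem norm_sq_eq_integral (f : Lp (Tensor d) 2 μ) : ‖f‖ ^ 2 = ∫ x, ‖f x‖ ^ 2 ∂μ := by
  rw [← real_inner_self_eq_norm_sq, L2.inner_def]
  simp only [real_inner_self_eq_norm_sq]

variable [IsFiniteMeasure μ]

theorem integrable_inner_stress (hp : 1 < p) (hδ : 0 ≤ δ) (hδ1 : δ ≤ 1)
    (hm : MemLp m (ENNReal.ofReal p) μ) (hm0 : ∀ x, 0 ≤ m x)
    (hLm : ∀ v, AEStronglyMeasurable (fun x => L x v) μ)
    (hL : ∀ x v, ‖L x v‖ ≤ m x * ‖v‖) (v ξ : V) :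
    Integrable (fun x => (inner ℝ (stress p δ (L x v)) (L x ξ) : ℝ)) μ := by
  refine (integrable_one_add_mul_rpow hp hm hm0
    ((norm_nonneg v).trans (le_max_left ‖v‖ ‖ξ‖))).mono'
    (((continuous_stress hp hδ).comp_aestronglyMeasurable (hLm v)).inner (hLm ξ))
    (.of_forall fun x => abs_inner_stress_le hp hδ hδ1 hm0 hL (le_max_left _ _) (le_max_right _ _) x)

theorem integrable_phi (hp : 1 < p) (hδ : 0 ≤ δ) (hδ1 : δ ≤ 1)
    (hm : MemLp m (ENNReal.ofReal p) μ) (hm0 : ∀ x, 0 ≤ m x)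
    (hLm : ∀ v, AEStronglyMeasurable (fun x => L x v) μ)
    (hL : ∀ x v, ‖L x v‖ ≤ m x * ‖v‖) (v : V) :
    Integrable (fun x => phi p δ ‖symPart (L x v)‖) μ := by
  refine (integrable_one_add_mul_rpow hp hm hm0 (norm_nonneg v)).mono'
    (((continuous_phi hp hδ).comp (continuous_symPart d).norm).comp_aestronglyMeasurable (hLm v))
    (.of_forall fun x => ?_)
  rw [Real.norm_of_nonneg (phi_nonneg hp hδ (norm_nonneg _))]
  exact (phi_integrand_le hp hδ hδ1 _).trans (one_add_norm_rpow_le hp hm0 hL le_rfl x)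

/-- The Riesz representative of the stress form, written in an orthonormal basis; each coefficient
is continuous by dominated convergence. -/
theorem exists_stress_operator [FiniteDimensional ℝ V] (hp : 1 < p) (hδ : 0 ≤ δ) (hδ1 : δ ≤ 1)
    (hm : MemLp m (ENNReal.ofReal p) μ) (hm0 : ∀ x, 0 ≤ m x)
    (hLm : ∀ v, AEStronglyMeasurable (fun x => L x v) μ)
    (hL : ∀ x v, ‖L x v‖ ≤ m x * ‖v‖) :
    ∃ A : V → V, Continuous A ∧
      ∀ v ξ, inner ℝ (A v) ξ = ∫ x, inner ℝ (stress p δ (L x v)) (L x ξ) ∂μ := by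
  let b := stdOrthonormalBasis ℝ V
  refine ⟨fun v => ∑ i, (∫ x, inner ℝ (stress p δ (L x v)) (L x (b i)) ∂μ) • b i, ?_, fun v ξ => ?_⟩
  · refine continuous_finsetSum _ fun i _ => Continuous.smul ?_ continuous_const
    rw [continuous_iff_continuousAt]
    intro v
    have hR : 0 ≤ max (‖v‖ + 1) ‖b i‖ := (norm_nonneg (b i)).trans (le_max_right _ _)
    refine continuousAt_of_dominated (bound := fun x => (1 + max (‖v‖ + 1) ‖b i‖ * m x) ^ p)
      (.of_forall fun w => (integrable_inner_stress hp hδ hδ1 hm hm0 hLm hL w (b i)).1) ?_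
      (integrable_one_add_mul_rpow hp hm hm0 hR) (.of_forall fun x => ?_)
    · have h : ∀ᶠ w in 𝓝 v, ‖w‖ < ‖v‖ + 1 :=
        continuous_norm.continuousAt.eventually_lt continuousAt_const (by simp)
      filter_upwards [h] with w hw
      exact .of_forall fun x => abs_inner_stress_le hp hδ hδ1 hm0 hL
        (hw.le.trans (le_max_left _ _)) (le_max_right _ _) x
    · exact (((continuous_stress hp hδ).comp
        (L x).continuous_of_finiteDimensional).inner continuous_const).continuousAt
  · rw [sum_inner]
    simp only [real_inner_smul_left]
    conv_rhs => rw [← b.sum_repr' ξ]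
    simp only [map_sum, map_smul, inner_sum, real_inner_smul_right]
    rw [integral_finsetSum _ fun i _ =>
      (integrable_inner_stress hp hδ hδ1 hm hm0 hLm hL v (b i)).const_mul _]
    refine Finset.sum_congr rfl fun i _ => ?_
    rw [integral_const_mul, mul_comm]

theorem inner_stress_operator_le (hp : 1 < p) (hδ : 0 ≤ δ) (hδ1 : δ ≤ 1)
    (hm : MemLp m (ENNReal.ofReal p) μ) (hm0 : ∀ x, 0 ≤ m x)
    (hLm : ∀ v, AEStronglyMeasurable (fun x => L x v) μ)
    (hL : ∀ x v, ‖L x v‖ ≤ m x * ‖v‖) (hsym : ∀ x v, symPart (L x v) = L x v) (v w : V) :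
    ∫ x, inner ℝ (stress p δ (L x w)) (L x (v - w)) ∂μ
      ≤ ∫ x, phi p δ ‖symPart (L x v)‖ ∂μ - ∫ x, phi p δ ‖symPart (L x w)‖ ∂μ := by
  have hv := integrable_phi hp hδ hδ1 hm hm0 hLm hL v
  have hw := integrable_phi hp hδ hδ1 hm hm0 hLm hL w
  rw [← integral_sub hv hw]
  refine integral_mono (integrable_inner_stress hp hδ hδ1 hm hm0 hLm hL w (v - w)) (hv.sub hw)
    fun x => ?_
  have h := inner_stress_sub_le hp hδ (L x v) (L x w)
  -- The values of `L` are symmetric, so the difference of symmetric parts in the pointwise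
  -- inequality is `L x (v - w)` itself.
  rwa [hsym x v, hsym x w, ← map_sub, ← hsym x v, ← hsym x w, stress_symPart] at h

theorem memLp_natF (hp : 1 < p) (hδ : 0 ≤ δ) (hδ1 : δ ≤ 1)
    (hm : MemLp m (ENNReal.ofReal p) μ) (hm0 : ∀ x, 0 ≤ m x)
    (hLm : ∀ v, AEStronglyMeasurable (fun x => L x v) μ)
    (hL : ∀ x v, ‖L x v‖ ≤ m x * ‖v‖) (v : V) : MemLp (fun x => natF p δ (L x v)) 2 μ := by
  have hmeas := (continuous_natF hp hδ).comp_aestronglyMeasurable (hLm v)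
  rw [memLp_two_iff_integrable_sq_norm hmeas]
  refine (integrable_one_add_mul_rpow hp hm hm0 (norm_nonneg v)).mono' (hmeas.norm.pow 2)
    (.of_forall fun x => ?_)
  rw [Real.norm_of_nonneg (by positivity)]
  exact (natF_sq_le hp hδ hδ1 _).trans (one_add_norm_rpow_le hp hm0 hL le_rfl x)

/-- Continuity of `v ↦ F(Dv)` into `L²` supplies the time measurability of `F(Du)`; the norm bound
is the integrated comparison of `|F|²` with `φ`. -/
theorem exists_natF_operator [FiniteDimensional ℝ V] (hp : 1 < p) (hδ : 0 ≤ δ) (hδ1 : δ ≤ 1)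
    (hm : MemLp m (ENNReal.ofReal p) μ) (hm0 : ∀ x, 0 ≤ m x)
    (hLm : ∀ v, AEStronglyMeasurable (fun x => L x v) μ)
    (hL : ∀ x v, ‖L x v‖ ≤ m x * ‖v‖) :
    ∃ Ψ : V → Lp (Tensor d) 2 μ, Continuous Ψ ∧ (∀ v, Ψ v =ᵐ[μ] fun x => natF p δ (L x v)) ∧
      ∀ v, ‖Ψ v‖ ^ 2 ≤ 2 ^ (p + 1) * ∫ x, phi p δ ‖symPart (L x v)‖ ∂μ := by
  have hF := memLp_natF hp hδ hδ1 hm hm0 hLm hL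
  refine ⟨fun v => (hF v).toLp _, ?_, fun v => (hF v).coeFn_toLp, fun v => ?_⟩
  · rw [continuous_iff_continuousAt]
    intro v
    have hn : ∀ w, ‖(hF w).toLp _ - (hF v).toLp _‖ ^ 2
        = ∫ x, ‖natF p δ (L x w) - natF p δ (L x v)‖ ^ 2 ∂μ := fun w => by
      rw [← MemLp.toLp_sub, norm_sq_eq_integral]
      refine integral_congr_ae ?_
      filter_upwards [((hF w).sub (hF v)).coeFn_toLp] with x hx
      rw [hx]
      rfl
    have hc : ContinuousAt (fun w => ∫ x, ‖natF p δ (L x w) - natF p δ (L x v)‖ ^ 2 ∂μ) v := by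
      -- The `4` comes from `|a - b|² ≤ 2|a|² + 2|b|²`, both squares having the same majorant.
      refine continuousAt_of_dominated (bound := fun x => 4 * (1 + (‖v‖ + 1) * m x) ^ p)
        (.of_forall fun w => (((hF w).1.sub (hF v).1).norm.pow 2)) ?_
        ((integrable_one_add_mul_rpow hp hm hm0 (by positivity)).const_mul 4)
        (.of_forall fun x => ?_)
      · have h : ∀ᶠ w in 𝓝 v, ‖w‖ < ‖v‖ + 1 :=
          continuous_norm.continuousAt.eventually_lt continuousAt_const (by simp)
        filter_upwards [h] with w hw
        refine .of_forall fun x => ?_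
        rw [Real.norm_of_nonneg (by positivity)]
        have h1 := (natF_sq_le hp hδ hδ1 (L x w)).trans (one_add_norm_rpow_le hp hm0 hL hw.le x)
        have h2 := (natF_sq_le hp hδ hδ1 (L x v)).trans
          (one_add_norm_rpow_le hp hm0 hL (lt_add_one ‖v‖).le x)
        have h3 := pow_le_pow_left₀ (norm_nonneg _)
          (norm_sub_le (natF p δ (L x w)) (natF p δ (L x v))) 2
        nlinarith [sq_nonneg (‖natF p δ (L x w)‖ - ‖natF p δ (L x v)‖)]
      · exact (((((continuous_natF hp hδ).comp (L x).continuous_of_finiteDimensional).sub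
          continuous_const).norm).pow 2).continuousAt
    have h0 : Tendsto (fun w => ‖(hF w).toLp _ - (hF v).toLp _‖ ^ 2) (𝓝 v) (𝓝 0) := by
      simp only [hn]
      simpa using hc.tendsto
    rw [ContinuousAt, tendsto_iff_norm_sub_tendsto_zero]
    have h1 := (Real.continuous_sqrt.tendsto 0).comp h0
    simpa [Function.comp_def, Real.sqrt_sq (norm_nonneg _)] using h1
  · rw [norm_sq_eq_integral, ← integral_const_mul]
    refine integral_mono_ae (((memLp_two_iff_integrable_sq_norm (Lp.aestronglyMeasurable _)).1
      (Lp.memLp _))) ((integrable_phi hp hδ hδ1 hm hm0 hLm hL v).const_mul _) ?_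
    filter_upwards [(hF v).coeFn_toLp] with x hx
    simp only [hx, norm_natF_sq hδ]
    exact phiDeriv_mul_le hp hδ (norm_nonneg _)

end

/-! ### Weak gradients -/

/-- The fundamental lemma of the calculus of variations, applied to each component. It makes the
arbitrary choice in `weakGrad` harmless and `weakGrad` linear almost everywhere. -/
theorem HasWeakGrad.ae_eq {d : ℕ} {Ω : Set (Vec d)} (hΩ : IsOpen Ω) {v : Vec d → Vec d}
    {G H : Vec d → Tensor d} (hG : HasWeakGrad Ω v G) (hH : HasWeakGrad Ω v H) :
    G =ᵐ[dom Ω] H := by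
  have key : ∀ ij : Fin d × Fin d, ∀ᵐ x ∂volume, x ∈ Ω → (G - H) x ij = 0 := fun ij => by
    have hloc : LocallyIntegrableOn (fun x => (G - H) x ij) Ω volume := fun x hx => by
      obtain ⟨t, ht, hi⟩ := (hG.locInt_grad.sub hH.locInt_grad) x hx
      exact ⟨t, ht, (EuclideanSpace.proj ij : Tensor d →L[ℝ] ℝ).integrable_comp hi⟩
    refine hΩ.ae_eq_zero_of_integral_contDiff_smul_eq_zero hloc fun η h1 h2 h3 => ?_
    have e1 : ∫ x, η x • (G - H) x ij = ∫ x in Ω, η x • (G - H) x ij :=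
      (setIntegral_eq_integral_of_forall_compl_eq_zero fun x hx => by
        rw [image_eq_zero_of_notMem_tsupport fun h => hx (h3 h), zero_smul]).symm
    have e2 := hG.integral_eq η h1 h2 h3 ij.1 ij.2
    have e3 := hH.integral_eq η h1 h2 h3 ij.1 ij.2
    rw [e1]
    simp only [Pi.sub_apply, PiLp.sub_apply, smul_eq_mul, mul_sub]
    rw [integral_sub (integrableOn_mul_coord hG.locInt_grad h1.continuous h2 h3 ij)
      (integrableOn_mul_coord hH.locInt_grad h1.continuous h2 h3 ij)]
    linarith
  rw [Filter.EventuallyEq, ae_restrict_iff' hΩ.measurableSet]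
  filter_upwards [ae_all_iff.2 key] with x hx hxΩ
  ext ij
  exact sub_eq_zero.1 (hx ij hxΩ)

theorem HasWeakGrad.weakGrad_ae_eq {d : ℕ} {Ω : Set (Vec d)} (hΩ : IsOpen Ω) {v : Vec d → Vec d}
    {G : Vec d → Tensor d} (hG : HasWeakGrad Ω v G) : weakGrad Ω v =ᵐ[dom Ω] G := by
  have h : ∃ G, HasWeakGrad Ω v G := ⟨G, hG⟩
  rw [weakGrad, dif_pos h]
  exact h.choose_spec.ae_eq hΩ hG

theorem MemW0.hasWeakGrad {d : ℕ} {p : ℝ} {Ω : Set (Vec d)} (hΩ : IsOpen Ω) {v : Vec d → Vec d}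
    (hv : MemW0 p Ω v) : HasWeakGrad Ω v (weakGrad Ω v) := by
  obtain ⟨G, hG, -⟩ := hv
  exact hG.congr .rfl (hG.weakGrad_ae_eq hΩ).symm

theorem MemW0.memLp_weakGrad {d : ℕ} {p : ℝ} {Ω : Set (Vec d)} (hΩ : IsOpen Ω)
    {v : Vec d → Vec d} (hv : MemW0 p Ω v) : MemLp (weakGrad Ω v) (ENNReal.ofReal p) (dom Ω) := by
  obtain ⟨G, hG, -, hGp, -⟩ := hv
  exact hGp.ae_eq (hG.weakGrad_ae_eq hΩ).symm

theorem weakGrad_add_ae {d : ℕ} {p : ℝ} {Ω : Set (Vec d)} (hΩ : IsOpen Ω) {v w : Field d Ω}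
    (hv : v ∈ W0 p Ω) (hw : w ∈ W0 p Ω) :
    weakGrad Ω (v + w : Field d Ω) =ᵐ[dom Ω] weakGrad Ω v + weakGrad Ω w :=
  (((MemW0.hasWeakGrad hΩ hv).add (MemW0.hasWeakGrad hΩ hw)).congr
    (AEEqFun.coeFn_add v w).symm .rfl).weakGrad_ae_eq hΩ

theorem weakGrad_smul_ae {d : ℕ} {p : ℝ} {Ω : Set (Vec d)} (hΩ : IsOpen Ω) (c : ℝ) {v : Field d Ω}
    (hv : v ∈ W0 p Ω) :
    weakGrad Ω (c • v : Field d Ω) =ᵐ[dom Ω] c • weakGrad Ω v :=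
  (((MemW0.hasWeakGrad hΩ hv).const_smul c).congr
    (AEEqFun.coeFn_smul c v).symm .rfl).weakGrad_ae_eq hΩ

theorem weakGrad_zero_ae {d : ℕ} {Ω : Set (Vec d)} (hΩ : IsOpen Ω) :
    weakGrad Ω (0 : Field d Ω) =ᵐ[dom Ω] 0 :=
  ((HasWeakGrad.zero Ω).congr AEEqFun.coeFn_zero.symm .rfl).weakGrad_ae_eq hΩ

theorem memLp_symGrad {d : ℕ} {p : ℝ} {Ω : Set (Vec d)} (hΩ : IsOpen Ω) {v : Vec d → Vec d}
    (hv : MemW0 p Ω v) : MemLp (symGrad Ω v) (ENNReal.ofReal p) (dom Ω) :=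
  (hv.memLp_weakGrad hΩ).of_le
    ((continuous_symPart d).comp_aestronglyMeasurable (hv.memLp_weakGrad hΩ).1)
    (.of_forall fun _ => norm_symPart_le _)

theorem memLp_weakDiv {d : ℕ} {p : ℝ} {Ω : Set (Vec d)} (hΩ : IsOpen Ω) {v : Vec d → Vec d}
    (hv : MemW0 p Ω v) : MemLp (weakDiv Ω v) (ENNReal.ofReal p) (dom Ω) :=
  memLp_finsetSum _ fun i _ => (hv.memLp_weakGrad hΩ).continuousLinearMap_comp
    (EuclideanSpace.proj (i, i) : Tensor d →L[ℝ] ℝ)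

theorem integrable_mul_weakDiv {d : ℕ} {p : ℝ} (hp : 1 < p) {Ω : Set (Vec d)} (hΩ : IsOpen Ω)
    {v : Vec d → Vec d} (hv : MemW0 p Ω v) {q : Vec d → ℝ} (hq : MemLp q (conjExp p) (dom Ω)) :
    Integrable (fun x => q x * weakDiv Ω v x) (dom Ω) := by
  have h : ENNReal.HolderConjugate (conjExp p) (ENNReal.ofReal p) :=
    ((Real.HolderConjugate.conjExponent hp).ennrealOfReal).symm
  exact hq.integrable_mul (memLp_weakDiv hΩ hv)

/-! ### The finite-dimensional velocity space -/

/-- The discretely divergence-free fields as a subspace of `L²(Ω)`. -/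
noncomputable def divFreeSubmodule {d : ℕ} {Ω : Set (Vec d)} {p : ℝ} (hp : 1 < p) (hΩ : IsOpen Ω)
    (X : Submodule ℝ (Field d Ω)) (Y : Submodule ℝ (Scalar d Ω)) (hX : X ≤ W0 p Ω)
    (hY : Y ≤ Lp.LpSubmodule ℝ ℝ (conjExp p) (dom Ω)) : Submodule ℝ (L2 d Ω) where
  carrier := {ξ | (ξ : Field d Ω) ∈ discDivFree X Y}
  add_mem' {v w} hv hw := by
    refine ⟨add_mem hv.1 hw.1, fun q hq => ?_⟩
    have hq' : MemLp q (conjExp p) (dom Ω) := Lp.mem_Lp_iff_memLp.1 (hY hq)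
    have h : ∫ x in Ω, q x * weakDiv Ω ((v + w : L2 d Ω) : Field d Ω) x
        = ∫ x in Ω, (q x * weakDiv Ω v x + q x * weakDiv Ω w x) := by
      refine integral_congr_ae ?_
      filter_upwards [weakGrad_add_ae hΩ (hX hv.1) (hX hw.1)] with x hx
      rw [← mul_add]
      congr 1
      simp only [weakDiv, ← Finset.sum_add_distrib]
      exact Finset.sum_congr rfl fun i _ => congrArg (fun A : Tensor d => A (i, i)) hx
    rw [h, integral_add (integrable_mul_weakDiv hp hΩ (hX hv.1) hq')
      (integrable_mul_weakDiv hp hΩ (hX hw.1) hq'), hv.2 q hq, hw.2 q hq, add_zero]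
  zero_mem' := by
    refine ⟨zero_mem X, fun q _ => ?_⟩
    rw [← integral_zero (Vec d) ℝ (μ := dom Ω)]
    refine integral_congr_ae ?_
    filter_upwards [weakGrad_zero_ae hΩ] with x hx
    have h : weakDiv Ω ((0 : L2 d Ω) : Field d Ω) x = 0 :=
      Finset.sum_eq_zero fun i _ => congrArg (fun A : Tensor d => A (i, i)) hx
    rw [h, mul_zero]
  smul_mem' c v hv := by
    refine ⟨X.smul_mem c hv.1, fun q hq => ?_⟩
    have h : ∫ x in Ω, q x * weakDiv Ω ((c • v : L2 d Ω) : Field d Ω) x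
        = ∫ x in Ω, c * (q x * weakDiv Ω v x) := by
      refine integral_congr_ae ?_
      filter_upwards [weakGrad_smul_ae hΩ c (hX hv.1)] with x hx
      rw [mul_left_comm]
      congr 1
      simp only [weakDiv, Finset.mul_sum]
      exact Finset.sum_congr rfl fun i _ => congrArg (fun A : Tensor d => A (i, i)) hx
    rw [h, integral_const_mul, hv.2 q hq, mul_zero]

/-- Restriction of a class of vector fields to a simplex. -/
noncomputable def restrictCell {d : ℕ} {Ω : Set (Vec d)} (𝒯 : Mesh Ω) (s : 𝒯.cells) :
    Field d Ω →ₗ[ℝ] Field d (openCell s.1) where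
  toFun v := AEEqFun.mk v (v.aestronglyMeasurable.mono_measure
    (Measure.restrict_mono_set volume (show openCell s.1 ⊆ Ω from 𝒯.subset s.1 s.2)))
  map_add' v w := by
    rw [AEEqFun.mk_add_mk, AEEqFun.mk_eq_mk]
    exact 𝒯.ae_openCell s.2 (AEEqFun.coeFn_add v w)
  map_smul' c v := by
    rw [RingHom.id_apply, AEEqFun.smul_mk, AEEqFun.mk_eq_mk]
    exact 𝒯.ae_openCell s.2 (AEEqFun.coeFn_smul c v)

theorem continuous_polyField {d : ℕ} (P : Fin d → MvPolynomial (Fin d) ℝ) :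
    Continuous fun x : Vec d =>
      (WithLp.toLp 2 fun j => MvPolynomial.eval (fun i => x i) (P j) : Vec d) := by
  refine (PiLp.continuous_toLp 2 _).comp (continuous_pi fun j => ?_)
  exact (MvPolynomial.continuous_eval (P j)).comp (PiLp.continuous_ofLp 2 _)

/-- Polynomial fields of degree at most `k` as classes of vector fields on a set. -/
noncomputable def polyField {d : ℕ} (U : Set (Vec d)) (k : ℕ) :
    (Fin d → MvPolynomial.restrictTotalDegree (Fin d) ℝ k) →ₗ[ℝ] Field d U where
  toFun P := AEEqFun.mk _ (continuous_polyField fun j => (P j).1).aestronglyMeasurable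
  map_add' P Q := by
    rw [AEEqFun.mk_add_mk]
    congr 1
    ext x j
    simp
  map_smul' c P := by
    rw [RingHom.id_apply, AEEqFun.smul_mk]
    congr 1
    ext x j
    simp

theorem restrictCell_mem_range {d : ℕ} {Ω : Set (Vec d)} {p : ℝ} {𝒯 : Mesh Ω} {k : ℕ}
    (s : 𝒯.cells) {v : Field d Ω} (hv : v ∈ velocitySpace p 𝒯 k) :
    restrictCell 𝒯 s v ∈ LinearMap.range (polyField (openCell s.1) k) := by
  choose P hP hvP using fun j => hv.2 j s.1 s.2
  refine ⟨fun j => ⟨P j, (MvPolynomial.mem_restrictTotalDegree _ _ _).2 (hP j)⟩, ?_⟩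
  refine AEEqFun.mk_eq_mk.2 ?_
  filter_upwards [ae_all_iff.2 hvP] with x hx
  ext j
  exact (hx j).symm

/-- The closed cells cover `Ω`, and the boundary of a convex set is a null set. -/
theorem Mesh.ae_of_forall_cell {d : ℕ} {Ω : Set (Vec d)} (hΩ : IsOpen Ω) (𝒯 : Mesh Ω)
    {q : Vec d → Prop} (h : ∀ s ∈ 𝒯.cells, ∀ᵐ x ∂(volume.restrict (openCell s)), q x) :
    ∀ᵐ x ∂(dom Ω), q x := by
  have h1 : ∀ᵐ x ∂(volume : Measure (Vec d)), ∀ s ∈ 𝒯.cells, x ∈ openCell s → q x :=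
    (Finset.eventually_all _).2 fun s hs =>
      (ae_restrict_iff' isOpen_interior.measurableSet).1 (h s hs)
  have h2 : ∀ᵐ x ∂(volume : Measure (Vec d)), ∀ s ∈ 𝒯.cells, x ∉ frontier (closedCell s) :=
    (Finset.eventually_all _).2 fun s _ =>
      measure_eq_zero_iff_ae_notMem.1 ((convex_convexHull ℝ _).addHaar_frontier volume)
  rw [ae_restrict_iff' hΩ.measurableSet]
  filter_upwards [h1, h2] with x hx1 hx2 hxΩ
  have hx := subset_closure hxΩ
  rw [← 𝒯.cover] at hx
  obtain ⟨s, hs, hxs⟩ := mem_iUnion₂.1 hx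
  refine hx1 s hs ?_
  by_contra hn
  exact hx2 s hs ⟨subset_closure hxs, hn⟩

/-- Restriction to the cells embeds the space into a finite product of spaces of polynomial fields
of bounded degree. -/
theorem finiteDimensional_velocitySpace {d : ℕ} {Ω : Set (Vec d)} (hΩ : IsOpen Ω) (p : ℝ)
    (𝒯 : Mesh Ω) (k : ℕ) : FiniteDimensional ℝ (velocitySpace p 𝒯 k) := by
  let Φ : velocitySpace p 𝒯 k →ₗ[ℝ]
      ((s : 𝒯.cells) → LinearMap.range (polyField (openCell s.1) k)) :=
    LinearMap.pi fun s => ((restrictCell 𝒯 s).comp (velocitySpace p 𝒯 k).subtype).codRestrict _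
      fun v => restrictCell_mem_range s v.2
  have : IsNoetherian ℝ ((s : 𝒯.cells) → LinearMap.range (polyField (openCell s.1) k)) :=
    isNoetherian_of_isNoetherianRing_of_finite ℝ
      ((s : 𝒯.cells) → LinearMap.range (polyField (openCell s.1) k))
  refine Module.Finite.of_injective Φ fun v w hvw => Subtype.ext (AEEqFun.ext ?_)
  refine 𝒯.ae_of_forall_cell hΩ fun s hs => ?_
  exact AEEqFun.mk_eq_mk.1 (congrArg Subtype.val (congrFun hvw ⟨s, hs⟩))

theorem finiteDimensional_divFreeSubmodule {d : ℕ} {Ω : Set (Vec d)} {p : ℝ} (hp : 1 < p)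
    (hΩ : IsOpen Ω) {𝒯 : Mesh Ω} {k : ℕ}
    {X : Submodule ℝ (Field d Ω)} {Y : Submodule ℝ (Scalar d Ω)} (hX : X ≤ W0 p Ω)
    (hY : Y ≤ Lp.LpSubmodule ℝ ℝ (conjExp p) (dom Ω)) (hXk : X ≤ velocitySpace p 𝒯 k) :
    FiniteDimensional ℝ (divFreeSubmodule hp hΩ X Y hX hY) := by
  have := finiteDimensional_velocitySpace hΩ p 𝒯 k
  have : IsNoetherian ℝ (velocitySpace p 𝒯 k) :=
    isNoetherian_of_isNoetherianRing_of_finite ℝ (velocitySpace p 𝒯 k)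
  let Φ : divFreeSubmodule hp hΩ X Y hX hY →ₗ[ℝ] velocitySpace p 𝒯 k :=
    { toFun := fun v => ⟨(v : L2 d Ω), hXk v.2.1⟩
      map_add' := fun _ _ => rfl
      map_smul' := fun _ _ => rfl }
  exact Module.Finite.of_injective Φ fun v w hvw =>
    Subtype.ext (Subtype.ext (congrArg (fun z : velocitySpace p 𝒯 k => (z : Field d Ω)) hvw))

/-- `symGrad` is additive only outside a null set depending on the fields. Fixing representatives on
an orthonormal basis and extending linearly gives a version linear at every `x`, with envelope `m =
∑ |D bᵢ|`. -/
theorem exists_pointwise_symGrad {d : ℕ} {Ω : Set (Vec d)} {p : ℝ} (hΩ : IsOpen Ω)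
    (V : Submodule ℝ (L2 d Ω)) [FiniteDimensional ℝ V]
    (hV : ∀ v ∈ V, (v : Field d Ω) ∈ W0 p Ω) :
    ∃ (L : Vec d → V →ₗ[ℝ] Tensor d) (m : Vec d → ℝ), MemLp m (ENNReal.ofReal p) (dom Ω) ∧
      (∀ x, 0 ≤ m x) ∧ (∀ v, AEStronglyMeasurable (fun x => L x v) (dom Ω)) ∧
      (∀ x v, ‖L x v‖ ≤ m x * ‖v‖) ∧ (∀ x v, symPart (L x v) = L x v) ∧
      ∀ v : V, symGrad Ω (v : L2 d Ω) =ᵐ[dom Ω] fun x => L x v := by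
  let b := stdOrthonormalBasis ℝ V
  have hb : ∀ i, MemLp (symGrad Ω (b i : L2 d Ω)) (ENNReal.ofReal p) (dom Ω) := fun i =>
    memLp_symGrad hΩ (hV _ (b i).2)
  let L : Vec d → V →ₗ[ℝ] Tensor d := fun x =>
    ∑ i, (b.toBasis.coord i).smulRight (symGrad Ω (b i : L2 d Ω) x)
  have hL : ∀ x v, L x v = ∑ i, (inner ℝ (b i) v : ℝ) • symGrad Ω (b i : L2 d Ω) x := fun x v => by
    simp [L, b.repr_apply_apply]
  refine ⟨L, fun x => ∑ i, ‖symGrad Ω (b i : L2 d Ω) x‖, memLp_finsetSum _ fun i _ => (hb i).norm,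
    fun x => Finset.sum_nonneg fun i _ => norm_nonneg _, fun v => ?_, fun x v => ?_, fun x v => ?_,
    fun v => ?_⟩
  · simp only [hL]
    exact Finset.aestronglyMeasurable_fun_sum _ fun i _ => (hb i).1.fun_const_smul _
  · rw [hL, Finset.sum_mul]
    refine norm_sum_le_of_le _ fun i _ => ?_
    rw [norm_smul, mul_comm]
    refine mul_le_mul_of_nonneg_left ?_ (norm_nonneg _)
    simpa using norm_inner_le_norm (𝕜 := ℝ) (b i) v
  · rw [hL]
    change symPartL d _ = _
    simp only [map_sum, map_smul]
    exact Finset.sum_congr rfl fun i _ => congrArg _ (symPart_symPart _)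
  · have hv : v ∈ Submodule.span ℝ (range b) := by
      rw [← b.coe_toBasis, b.toBasis.span_eq]
      trivial
    induction hv using Submodule.span_induction with
    | mem v hv =>
      obtain ⟨i, rfl⟩ := hv
      refine .of_forall fun x => ?_
      simp only [hL, orthonormal_iff_ite.1 b.orthonormal, ite_smul, one_smul, zero_smul,
        Finset.sum_ite_eq', Finset.mem_univ, if_true]
    | zero =>
      filter_upwards [weakGrad_zero_ae hΩ] with x hx
      rw [map_zero]
      exact (congrArg (symPartL d) hx).trans (map_zero _)
    | add v w _ _ h1 h2 =>
      filter_upwards [weakGrad_add_ae hΩ (hV _ v.2) (hV _ w.2), h1, h2] with x hx h1 h2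
      rw [map_add, ← h1, ← h2]
      exact (congrArg (symPartL d) hx).trans (map_add _ _ _)
    | smul c v _ h1 =>
      filter_upwards [weakGrad_smul_ae hΩ c (hV _ v.2), h1] with x hx h1
      rw [map_smul, ← h1]
      exact (congrArg (symPartL d) hx).trans ((symPartL d).map_smul c (weakGrad Ω (v : L2 d Ω) x))

/-! ### The embedding of `W₀^{1,p}` into `L²` -/

theorem norm_fderiv_le_classGrad {d : ℕ} (v : Vec d → Vec d) (x : Vec d) :
    ‖fderiv ℝ v x‖ ≤ d * ‖classGrad v x‖ := by
  refine ContinuousLinearMap.opNorm_le_bound _ (by positivity) fun h => ?_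
  have h1 : fderiv ℝ v x h = ∑ i, h i • fderiv ℝ v x (EuclideanSpace.single i 1) := by
    conv_lhs => rw [← (EuclideanSpace.basisFun (Fin d) ℝ).sum_repr h]
    simp
  have h2 : ∀ i, ‖fderiv ℝ v x (EuclideanSpace.single i 1)‖ ≤ ‖classGrad v x‖ := fun i => by
    rw [EuclideanSpace.norm_eq, EuclideanSpace.norm_eq]
    refine Real.sqrt_le_sqrt ?_
    rw [Fintype.sum_prod_type]
    exact Finset.single_le_sum (f := fun i => ∑ j, ‖classGrad v x (i, j)‖ ^ 2)
      (fun _ _ => by positivity) (Finset.mem_univ i)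
  rw [h1]
  calc ‖∑ i, h i • fderiv ℝ v x (EuclideanSpace.single i 1)‖
      ≤ ∑ _i : Fin d, ‖h‖ * ‖classGrad v x‖ := by
        refine norm_sum_le_of_le _ fun i _ => ?_
        rw [norm_smul]
        exact mul_le_mul (PiLp.norm_apply_le h i) (h2 i) (norm_nonneg _) (norm_nonneg _)
    _ = d * ‖classGrad v x‖ * ‖h‖ := by
        rw [Finset.sum_const, Finset.card_univ, Fintype.card_fin, nsmul_eq_mul]
        ring

theorem exists_sobolev_const_smooth {d : ℕ} (hd : 2 ≤ d) {Ω : Set (Vec d)}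
    (hΩ : Bornology.IsBounded Ω) {p : ℝ} (hp1 : 1 < p)
    (hp : 2 * (d : ℝ) / (d + 2) ≤ p) (hp2 : p < 2) :
    ∃ C : ℝ≥0∞, C ≠ ⊤ ∧ ∀ η : Vec d → Vec d, ContDiff ℝ ∞ η → tsupport η ⊆ Ω →
      eLpNorm η 2 (dom Ω) ≤ C * eLpNorm (classGrad η) (ENNReal.ofReal p) (dom Ω) := by
  have hd' : (2 : ℝ) ≤ d := by exact_mod_cast hd
  have hfin : Module.finrank ℝ (Vec d) = d := by simp
  refine ⟨eLpNormLESNormFDerivOfLeConst (Vec d) volume Ω p.toNNReal 2 * d,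
    ENNReal.mul_ne_top ENNReal.coe_ne_top (by simp), fun η h1 h2 => ?_⟩
  have hle := eLpNorm_le_eLpNorm_fderiv_of_le (μ := (volume : Measure (Vec d))) (u := η) (s := Ω)
    (h1.of_le (by simp)) ((subset_tsupport η).trans h2) (p := p.toNNReal) (q := 2)
    (by rw [← NNReal.coe_le_coe, Real.coe_toNNReal _ (by linarith)]; simpa using hp1.le)
    (by
      rw [hfin, ← NNReal.coe_lt_coe, Real.coe_toNNReal _ (by linarith)]
      simpa using by linarith)
    (by
      rw [hfin, NNReal.coe_inv, Real.coe_toNNReal _ (by linarith)]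
      have hp0 : 0 < p := by linarith
      -- Inverting `p ≥ 2d/(d+2)` gives `1/p - 1/d ≤ 1/2`, the exponent condition in the
      -- Gagliardo-Nirenberg-Sobolev inequality.
      have h3 : p⁻¹ ≤ (2 * (d : ℝ) / (d + 2))⁻¹ := inv_anti₀ (by positivity) hp
      have h4 : (2 * (d : ℝ) / (d + 2))⁻¹ = 2⁻¹ + (d : ℝ)⁻¹ := by field_simp
      rw [h4] at h3
      simpa using by linarith) hΩ
  have hsupp : Function.support (fderiv ℝ η) ⊆ Ω :=
    ((subset_tsupport _).trans (tsupport_fderiv_subset ℝ)).trans h2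
  have h5 : eLpNorm (fderiv ℝ η) (p.toNNReal : ℝ≥0∞) volume
      ≤ d * eLpNorm (classGrad η) (ENNReal.ofReal p) (dom Ω) := by
    rw [← eLpNorm_restrict_eq_of_support_subset (f := fderiv ℝ η) hsupp]
    have := eLpNorm_le_mul_eLpNorm_of_ae_le_mul (μ := dom Ω) (f := fderiv ℝ η) (g := classGrad η)
      (c := d) (.of_forall (norm_fderiv_le_classGrad η)) (ENNReal.ofReal p)
    rwa [ENNReal.ofReal_natCast] at this
  calc eLpNorm η 2 (dom Ω) ≤ eLpNorm η 2 volume := eLpNorm_mono_measure _ Measure.restrict_le_self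
    _ ≤ _ := hle
    _ ≤ _ := by
      rw [mul_assoc]
      gcongr

/-- For `p < 2` the smooth inequality passes to the limit by Fatou along an a.e. convergent
subsequence of the approximations. For `p ≥ 2`, Hölder on the bounded set `Ω` suffices. -/
theorem exists_sobolev_const {d : ℕ} (hd : 2 ≤ d) {Ω : Set (Vec d)} (hΩo : IsOpen Ω)
    (hΩ : Bornology.IsBounded Ω) {p : ℝ} (hp1 : 1 < p) (hp : 2 * (d : ℝ) / (d + 2) ≤ p) :
    ∃ C : ℝ≥0∞, C ≠ ⊤ ∧ ∀ v : Vec d → Vec d, MemW0 p Ω v →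
      eLpNorm v 2 (dom Ω) ≤ C * sobolevNorm p Ω v := by
  rcases lt_or_ge p 2 with hp2 | hp2
  · obtain ⟨C, hC, hCη⟩ := exists_sobolev_const_smooth hd hΩ hp1 hp hp2
    refine ⟨C, hC, fun v hv => ?_⟩
    obtain ⟨G, hG, hvp, hGp, η, hη, h1, h2⟩ := hv
    have hηm : ∀ n, AEStronglyMeasurable (η n) (dom Ω) := fun n =>
      (hη n).1.continuous.aestronglyMeasurable
    have hgm : ∀ n, AEStronglyMeasurable (classGrad (η n)) (dom Ω) := fun n =>
      (continuous_classGrad (hη n).1).aestronglyMeasurable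
    have hp0 : ENNReal.ofReal p ≠ 0 := by simpa using by linarith
    have hmeas : TendstoInMeasure (dom Ω) η atTop v := by
      refine tendstoInMeasure_of_tendsto_eLpNorm hp0 hηm hvp.1 (h1.congr fun n => ?_)
      exact eLpNorm_sub_comm _ _ _ _
    obtain ⟨ns, hns, hae⟩ := hmeas.exists_seq_tendsto_ae
    have hb : ∀ n, eLpNorm (η n) 2 (dom Ω) ≤ C * (eLpNorm (G - classGrad (η n)) (ENNReal.ofReal p)
        (dom Ω) + eLpNorm G (ENNReal.ofReal p) (dom Ω)) := fun n => by
      refine (hCη (η n) (hη n).1 (hη n).2.2).trans (mul_le_mul_right ?_ C)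
      rw [eLpNorm_sub_comm]
      have := eLpNorm_add_le ((hgm n).sub hGp.1) hGp.1
        (ENNReal.one_le_ofReal.2 hp1.le)
      rwa [sub_add_cancel] at this
    have hlim : Tendsto (fun k => C * (eLpNorm (G - classGrad (η (ns k))) (ENNReal.ofReal p)
        (dom Ω) + eLpNorm G (ENNReal.ofReal p) (dom Ω))) atTop
        (𝓝 (C * (0 + eLpNorm G (ENNReal.ofReal p) (dom Ω)))) :=
      ENNReal.Tendsto.const_mul ((h2.comp hns.tendsto_atTop).add_const _) (Or.inr hC)
    calc eLpNorm v 2 (dom Ω) ≤ liminf (fun k => eLpNorm (η (ns k)) 2 (dom Ω)) atTop :=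
          Lp.eLpNorm_lim_le_liminf_eLpNorm (fun k => hηm (ns k)) v hae
      _ ≤ liminf (fun k => C * (eLpNorm (G - classGrad (η (ns k))) (ENNReal.ofReal p)
        (dom Ω) + eLpNorm G (ENNReal.ofReal p) (dom Ω))) atTop :=
          liminf_le_liminf (.of_forall fun k => hb (ns k))
      _ = C * eLpNorm G (ENNReal.ofReal p) (dom Ω) := by rw [hlim.liminf_eq, zero_add]
      _ ≤ C * sobolevNorm p Ω v := by
          rw [sobolevNorm, eLpNorm_congr_ae (hG.weakGrad_ae_eq hΩo)]
          gcongr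
          exact le_add_self
  · have hfin : volume Ω ≠ ⊤ := hΩ.measure_lt_top.ne
    refine ⟨volume Ω ^ (1 / (2 : ℝ) - 1 / p), ENNReal.rpow_ne_top_of_nonneg ?_ hfin,
      fun v hv => ?_⟩
    · rw [sub_nonneg]
      exact one_div_le_one_div_of_le two_pos hp2
    · obtain ⟨G, hG, hvp, -⟩ := hv
      have h2p : (2 : ℝ≥0∞) ≤ ENNReal.ofReal p := by
        rw [← ENNReal.ofReal_ofNat]
        exact ENNReal.ofReal_le_ofReal hp2
      have h := eLpNorm_le_eLpNorm_mul_rpow_measure_univ h2p hvp.1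
      rw [ENNReal.toReal_ofReal (by linarith), ENNReal.toReal_ofNat, Measure.restrict_apply_univ,
        mul_comm] at h
      exact h.trans (by rw [sobolevNorm]; gcongr; exact le_self_add)

/-! ### Norms of time-dependent functions -/

theorem eLpNorm_two_timeMeas {E : Type*} [NormedAddCommGroup E] {T : ℝ} (hT : 0 ≤ T) {h : ℝ → E}
    (hc : ContinuousOn h (Icc 0 T)) :
    eLpNorm h 2 (timeMeas T) = ENNReal.ofReal √(∫ t in 0..T, ‖h t‖ ^ 2) := by
  have hm : AEStronglyMeasurable h (timeMeas T) :=
    (hc.mono Ioo_subset_Icc_self).aestronglyMeasurable measurableSet_Ioo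
  have hi : Integrable (fun t => ‖h t‖ ^ 2) (timeMeas T) :=
    ((hc.norm.pow 2).integrableOn_compact isCompact_Icc).mono_set Ioo_subset_Icc_self
  rw [((memLp_two_iff_integrable_sq_norm hm).2 hi).eLpNorm_eq_integral_rpow_norm two_ne_zero
    ENNReal.ofNat_ne_top, intervalIntegral.integral_of_le hT, integral_Ioc_eq_integral_Ioo,
    Real.sqrt_eq_rpow]
  simp

theorem integral_sq_le_of_eLpNorm_le {E : Type*} [NormedAddCommGroup E] {T M : ℝ} (hT : 0 ≤ T)
    (hM : 0 ≤ M) {h : ℝ → E} (hc : ContinuousOn h (Icc 0 T))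
    (hle : eLpNorm h 2 (timeMeas T) ≤ ENNReal.ofReal M) : ∫ t in 0..T, ‖h t‖ ^ 2 ≤ M ^ 2 := by
  rw [eLpNorm_two_timeMeas hT hc, ENNReal.ofReal_le_ofReal_iff hM] at hle
  exact (Real.sqrt_le_left hM).1 hle

theorem eLpNorm_top_timeMeas_le {E : Type*} [NormedAddCommGroup E] {T C : ℝ} {h : ℝ → E}
    (hC : ∀ t ∈ Icc 0 T, ‖h t‖ ≤ C) : eLpNorm h ⊤ (timeMeas T) ≤ ENNReal.ofReal C := by
  rw [eLpNorm_exponent_top]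
  refine eLpNormEssSup_le_of_ae_bound ?_
  filter_upwards [ae_restrict_mem measurableSet_Ioo] with t ht
  exact hC t (Ioo_subset_Icc_self ht)

/-- Uses `‖u'‖ ≤ (1 + ‖u'‖²)/2` in place of the Cauchy-Schwarz inequality in time. -/
theorem norm_le_of_integral_deriv_sq_le {E : Type*} [NormedAddCommGroup E] [NormedSpace ℝ E]
    [CompleteSpace E] {T K : ℝ} {u u' : ℝ → E}
    (hu : ∀ t ∈ Icc 0 T, HasDerivWithinAt u (u' t) (Icc 0 T) t) (hc : ContinuousOn u' (Icc 0 T))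
    {t : ℝ} (ht : t ∈ Icc 0 T) (hK : ∫ s in 0..t, ‖u' s‖ ^ 2 ≤ K) :
    ‖u t‖ ≤ ‖u 0‖ + (T + K) / 2 := by
  have hsub : uIcc 0 t ⊆ Icc 0 T := uIcc_subset_Icc (left_mem_Icc.2 (ht.1.trans ht.2)) ht
  have hftc : ∫ s in 0..t, u' s = u t - u 0 := by
    refine intervalIntegral.integral_eq_sub_of_hasDeriv_right
      (fun s hs => ((hu s (hsub hs)).mono hsub).continuousWithinAt) (fun s hs => ?_)
      (hc.mono hsub).intervalIntegrable
    rw [min_eq_left ht.1, max_eq_right ht.1] at hs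
    exact (hu s ⟨hs.1.le, hs.2.le.trans ht.2⟩).mono_of_mem_nhdsWithin
      (mem_nhdsWithin_of_mem_nhds (Icc_mem_nhds hs.1 (hs.2.trans_le ht.2)))
  have i2 : IntervalIntegrable (fun s => ‖u' s‖ ^ 2) volume 0 t :=
    ((hc.norm.pow 2).mono hsub).intervalIntegrable
  have h1 : ∫ s in 0..t, ‖u' s‖ ≤ ∫ s in 0..t, (1 + ‖u' s‖ ^ 2) / 2 :=
    intervalIntegral.integral_mono_on ht.1 ((hc.norm.mono hsub).intervalIntegrable)
      ((intervalIntegrable_const.add i2).div_const 2)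
      fun s _ => by nlinarith [sq_nonneg (‖u' s‖ - 1)]
  rw [intervalIntegral.integral_div, intervalIntegral.integral_add intervalIntegrable_const i2,
    intervalIntegral.integral_const] at h1
  have h2 := intervalIntegral.norm_integral_le_integral_norm (μ := volume) (f := u') ht.1
  rw [hftc] at h2
  have h3 := norm_le_norm_add_norm_sub' (u t) (u 0)
  have h4 := ht.2
  simp only [sub_zero, smul_eq_mul, mul_one] at h1
  linarith

theorem integral_one_add_norm_rpow_le {d : ℕ} {Ω : Set (Vec d)} [IsFiniteMeasure (dom Ω)]
    {p M : ℝ} (hp : 1 < p) (hM : 0 ≤ M) {G : Vec d → Tensor d}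
    (hG : MemLp G (ENNReal.ofReal p) (dom Ω))
    (hle : eLpNorm G (ENNReal.ofReal p) (dom Ω) ≤ ENNReal.ofReal M) :
    ∫ x in Ω, (1 + ‖G x‖) ^ p
      ≤ ((eLpNorm (fun _ : Vec d => (1 : ℝ)) (ENNReal.ofReal p) (dom Ω)).toReal + M) ^ p := by
  have hp0 : ENNReal.ofReal p ≠ 0 := by simpa using by linarith
  have h1 : MemLp (fun _ : Vec d => (1 : ℝ)) (ENNReal.ofReal p) (dom Ω) := memLp_const 1
  have h2 : MemLp (fun x => 1 + ‖G x‖) (ENNReal.ofReal p) (dom Ω) := h1.add hG.norm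
  have h3 : eLpNorm (fun x => 1 + ‖G x‖) (ENNReal.ofReal p) (dom Ω) ≤ ENNReal.ofReal
      ((eLpNorm (fun _ : Vec d => (1 : ℝ)) (ENNReal.ofReal p) (dom Ω)).toReal + M) := by
    rw [ENNReal.ofReal_add ENNReal.toReal_nonneg hM, ENNReal.ofReal_toReal h1.2.ne]
    refine (eLpNorm_add_le h1.1 hG.norm.1 (ENNReal.one_le_ofReal.2 hp.le)).trans ?_
    rw [eLpNorm_norm]
    gcongr
  rw [h2.eLpNorm_eq_integral_rpow_norm hp0 ENNReal.ofReal_ne_top,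
    ENNReal.ofReal_le_ofReal_iff (by positivity), ENNReal.toReal_ofReal (by linarith),
    Real.rpow_inv_le_iff_of_pos (integral_nonneg fun _ => by positivity) (by positivity)
      (by linarith)] at h3
  refine le_of_eq_of_le (integral_congr_ae (.of_forall fun x => ?_)) h3
  have : 0 ≤ 1 + ‖G x‖ := by positivity
  simp only [Real.norm_of_nonneg this]

end GenStokes

/-! ### The semi-discrete problem: existence, uniqueness and a priori bounds -/

open GenStokes

theorem mainTheorem8 (d : ℕ) (hd : 2 ≤ d) (Ω : Set (GenStokes.Vec d)) (hΩ_open : IsOpen Ω)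
    (hΩ_conn : IsConnected Ω) (hΩ_bdd : Bornology.IsBounded Ω)
    (p : ℝ) (hp_one : 1 < p) (hp : 2 * (d : ℝ) / (d + 2) ≤ p) (T : ℝ) (hT : 0 < T)
    (M₁ M₂ : ℝ) (hM₁ : 0 < M₁) (hM₂ : 0 < M₂) :
    ∃ c : ℝ, ∀ (δ : ℝ), 0 ≤ δ → δ ≤ 1 →
      ∀ (𝒯 : GenStokes.Mesh Ω) (σ₀ : ℝ), 𝒯.Nondegenerate σ₀ →
      ∀ (k r : ℕ) (X : Submodule ℝ (GenStokes.Field d Ω)) (Y : Submodule ℝ (GenStokes.Scalar d Ω)),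
      X ≤ GenStokes.velocitySpace p 𝒯 k → Y ≤ GenStokes.pressureSpace p 𝒯 r →
      ∀ κ : ℝ, GenStokes.Admissible p 𝒯 X Y κ →
      ∀ f f' : ℝ → GenStokes.L2 d Ω, GenStokes.IsW12 T f f' →
      ∀ u₀ ∈ GenStokes.W0div p Ω,
      eLpNorm f 2 (GenStokes.timeMeas T) + eLpNorm f' 2 (GenStokes.timeMeas T)
        + GenStokes.sobolevNorm p Ω u₀ ≤ ENNReal.ofReal M₁ →
      ∀ u₀h : GenStokes.L2 d Ω, (u₀h : GenStokes.Field d Ω) ∈ GenStokes.discDivFree X Y →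
      GenStokes.sobolevNorm p Ω u₀h ≤ ENNReal.ofReal M₂ →
      ∃ u : ℝ → GenStokes.L2 d Ω,
        GenStokes.IsSolution p δ T (GenStokes.discDivFree X Y) f u₀h u ∧
        (∀ w : ℝ → GenStokes.L2 d Ω,
          GenStokes.IsSolution p δ T (GenStokes.discDivFree X Y) f u₀h w →
          ∀ t ∈ Set.Icc 0 T, w t = u t) ∧
        ∃ Φ : ℝ → GenStokes.L2T d Ω,
          (∀ t ∈ Set.Icc 0 T, Φ t =ᵐ[GenStokes.dom Ω]
            fun x => GenStokes.natF p δ (GenStokes.symGrad Ω (u t) x)) ∧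
          MeasureTheory.AEStronglyMeasurable Φ (GenStokes.timeMeas T) ∧
          eLpNorm u ⊤ (GenStokes.timeMeas T) + eLpNorm Φ 2 (GenStokes.timeMeas T)
            ≤ ENNReal.ofReal c ∧
          eLpNorm (derivWithin u (Set.Icc 0 T)) 2 (GenStokes.timeMeas T)
            + eLpNorm Φ ⊤ (GenStokes.timeMeas T) ≤ ENNReal.ofReal c := by
  have hdom : IsFiniteMeasure (dom Ω) :=
    ⟨by rw [Measure.restrict_apply_univ]; exact hΩ_bdd.measure_lt_top⟩
  obtain ⟨C, hC, hCv⟩ := exists_sobolev_const hd hΩ_open hΩ_bdd hp_one hp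
  -- `S` bounds `‖u₀h‖` in `L²`, `K₀` the initial energy, `E₀` the energy at all times, `B₁` the
  -- `L^∞(L²)` norm of `u` and `B₂` that of `F(Du)`. All are fixed before `δ` and the mesh are
  -- chosen.
  set S : ℝ := (C * ENNReal.ofReal M₂).toReal
  set K₀ : ℝ := ((eLpNorm (fun _ : Vec d => (1 : ℝ)) (ENNReal.ofReal p) (dom Ω)).toReal + M₂) ^ p
  have hK₀ : 0 ≤ K₀ := by positivity
  set E₀ : ℝ := K₀ + M₁ ^ 2 / 2 with hE₀_def
  have hE₀ : 0 ≤ E₀ := by positivity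
  set B₁ : ℝ := S + (T + 2 * E₀) / 2 with hB₁_def
  set B₂ : ℝ := √(2 ^ (p + 1) * E₀)
  have hS : 0 ≤ S := ENNReal.toReal_nonneg
  have hB₁ : 0 ≤ B₁ := by positivity
  have hB₂ : 0 ≤ B₂ := Real.sqrt_nonneg _
  -- The sum of the bounds for all four norms; each of the two estimates uses one pair and drops the
  -- other.
  refine ⟨B₁ + √(T * B₂ ^ 2) + (√(2 * E₀) + B₂), fun δ hδ hδ1 𝒯 _ _ k r X Y hX hY _ _ f f' hf u₀ _
    hM u₀h hu₀h hu₀M => ?_⟩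
  have hX0 : X ≤ W0 p Ω := hX.trans fun v hv => hv.1
  have hY0 : Y ≤ Lp.LpSubmodule ℝ ℝ (conjExp p) (dom Ω) := hY.trans fun q hq => hq.1
  let V := divFreeSubmodule hp_one hΩ_open X Y hX0 hY0
  have hVfin : FiniteDimensional ℝ V :=
    finiteDimensional_divFreeSubmodule hp_one hΩ_open hX0 hY0 hX
  have hVW : ∀ v ∈ V, (v : Field d Ω) ∈ W0 p Ω := fun v hv => hX0 hv.1
  obtain ⟨L, m, hm, hm0, hLm, hL, hsym, hLgrad⟩ := exists_pointwise_symGrad hΩ_open V hVW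
  obtain ⟨A, hAc, hA⟩ := exists_stress_operator hp_one hδ hδ1 hm hm0 hLm hL
  obtain ⟨Ψ, hΨc, hΨ, hΨJ⟩ := exists_natF_operator hp_one hδ hδ1 hm hm0 hLm hL
  let J : V → ℝ := fun v => ∫ x in Ω, phi p δ ‖symPart (L x v)‖
  have hJ0 : ∀ v, 0 ≤ J v := fun v =>
    integral_nonneg fun x => phi_nonneg hp_one hδ (norm_nonneg _)
  have hJ : ∀ v w, inner ℝ (A w) (v - w) ≤ J v - J w := fun v w => by
    rw [hA]
    exact inner_stress_operator_le hp_one hδ hδ1 hm hm0 hLm hL hsym v w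
  have hA0 : A 0 = 0 := by
    refine ext_inner_right ℝ fun ξ => ?_
    rw [hA]
    simp [stress, show symPart (0 : Tensor d) = 0 from map_zero (symPartL d)]
  have hmono : ∀ v w, 0 ≤ inner ℝ (A v - A w) (v - w) := fun v w => by
    have h1 := hJ v w
    have h2 := hJ w v
    rw [← neg_sub v w, inner_neg_right] at h2
    rw [inner_sub_left]
    linarith
  have hAconv : ∀ v ξ : V, ∫ x in Ω, inner ℝ (stress p δ (symGrad Ω (v : L2 d Ω) x))
      (symGrad Ω (ξ : L2 d Ω) x) = inner ℝ (A v) ξ := fun v ξ => by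
    rw [hA]
    refine integral_congr_ae ?_
    filter_upwards [hLgrad v, hLgrad ξ] with x h1 h2
    rw [h1, h2]
  -- Test fields in `V` do not distinguish `f` from its projection, and projecting does not increase
  -- the norm.
  let g : ℝ → V := fun t => V.orthogonalProjectionOnto (f t)
  have hgc : ContinuousOn g (Icc 0 T) :=
    V.orthogonalProjectionOnto.continuous.comp_continuousOn hf.continuousOn
  have hg : ∀ t (ξ : V), inner ℝ (g t) ξ = inner ℝ (f t) (ξ : L2 d Ω) := fun t ξ =>
    Submodule.inner_orthogonalProjectionOnto_eq_of_mem_right ξ (f t)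
  obtain ⟨u, hu0, hu⟩ := exists_solution_of_monotone hT.le hAc hA0 hmono hgc ⟨u₀h, hu₀h⟩
  have huc : ContinuousOn u (Icc 0 T) := fun t ht => (hu t ht).continuousWithinAt
  have hu'c : ContinuousOn (fun t => g t - A (u t)) (Icc 0 T) :=
    hgc.sub (hAc.comp_continuousOn huc)
  have hU : ∀ t ∈ Icc 0 T, HasDerivWithinAt (fun t => (u t : L2 d Ω))
      ((g t - A (u t) : V) : L2 d Ω) (Icc 0 T) t := fun t ht =>
    V.subtypeL.hasFDerivAt.comp_hasDerivWithinAt t (hu t ht)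
  have hUd : EqOn (derivWithin (fun t => (u t : L2 d Ω)) (Icc 0 T))
      (fun t => ((g t - A (u t) : V) : L2 d Ω)) (Icc 0 T) := fun t ht =>
    (hU t ht).derivWithin (uniqueDiffOn_Icc hT t ht)
  have hUdc : ContinuousOn (derivWithin (fun t => (u t : L2 d Ω)) (Icc 0 T)) (Icc 0 T) :=
    (V.subtypeL.continuous.comp_continuousOn hu'c).congr hUd
  -- Pointwise `φ(|Du₀h|) ≤ (1 + |∇u₀h|)^p`, and Minkowski bounds the integral by the `W^{1,p}`
  -- norm.
  have hJu₀ : J (u 0) ≤ K₀ := by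
    have hv : MemW0 p Ω u₀h := hX0 hu₀h.1
    refine le_trans ?_ (integral_one_add_norm_rpow_le hp_one hM₂.le (hv.memLp_weakGrad hΩ_open)
      (le_add_self.trans hu₀M))
    refine integral_mono_ae (integrable_phi hp_one hδ hδ1 hm hm0 hLm hL (u 0)) ?_ ?_
    · have h := integrable_one_add_mul_rpow hp_one (hv.memLp_weakGrad hΩ_open).norm
        (fun _ => norm_nonneg _) zero_le_one
      simpa using h
    · filter_upwards [hLgrad (u 0)] with x hx
      refine (phi_integrand_le hp_one hδ hδ1 _).trans
        (Real.rpow_le_rpow (by positivity) ?_ (by linarith))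
      rw [hsym, ← hx, hu0]
      gcongr
      exact norm_symPart_le _
  have hfM : ∫ t in 0..T, ‖f t‖ ^ 2 ≤ M₁ ^ 2 :=
    integral_sq_le_of_eLpNorm_le hT.le hM₁.le hf.continuousOn
      ((le_self_add.trans le_self_add).trans hM)
  have henergy : ∀ t ∈ Icc 0 T, J (u t) + (∫ s in 0..t, ‖g s - A (u s)‖ ^ 2) / 2 ≤ E₀ := by
    intro t ht
    have h0T : (0 : ℝ) ∈ Icc 0 T := left_mem_Icc.2 hT.le
    have hsub : uIcc 0 t ⊆ Icc 0 T := uIcc_subset_Icc h0T ht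
    have h1 := energy_le hAc hJ hgc hu ht
    have h2 : ∫ s in 0..t, ‖g s‖ ^ 2 ≤ ∫ s in 0..t, ‖f s‖ ^ 2 :=
      intervalIntegral.integral_mono_on ht.1 ((hgc.norm.pow 2).mono hsub).intervalIntegrable
        ((hf.continuousOn.norm.pow 2).mono hsub).intervalIntegrable fun s _ =>
        pow_le_pow_left₀ (norm_nonneg _) (V.norm_orthogonalProjectionOnto_apply_le (f s)) 2
    have h3 : ∫ s in 0..t, ‖f s‖ ^ 2 ≤ ∫ s in 0..T, ‖f s‖ ^ 2 :=
      intervalIntegral.integral_mono_interval le_rfl ht.1 ht.2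
        (.of_forall fun s => by positivity)
        ((hf.continuousOn.norm.pow 2).mono
          (uIcc_subset_Icc h0T (right_mem_Icc.2 hT.le))).intervalIntegrable
    linarith
  have hu' : ∀ t ∈ Icc 0 T, ∫ s in 0..t, ‖g s - A (u s)‖ ^ 2 ≤ 2 * E₀ := fun t ht => by
    linarith [henergy t ht, hJ0 (u t)]
  have hΨB : ∀ t ∈ Icc 0 T, ‖Ψ (u t)‖ ≤ B₂ := fun t ht => by
    refine Real.le_sqrt_of_sq_le ((hΨJ (u t)).trans (mul_le_mul_of_nonneg_left ?_ (by positivity)))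
    have h1 : 0 ≤ ∫ s in 0..t, ‖g s - A (u s)‖ ^ 2 :=
      intervalIntegral.integral_nonneg ht.1 fun s _ => by positivity
    linarith [henergy t ht]
  have hu₀S : ‖u 0‖ ≤ S := by
    rw [hu0]
    change ‖u₀h‖ ≤ S
    rw [Lp.norm_def]
    refine ENNReal.toReal_mono (ENNReal.mul_ne_top hC ENNReal.ofReal_ne_top) ?_
    exact (hCv u₀h (hX0 hu₀h.1)).trans (mul_le_mul_right hu₀M C)
  have huB : ∀ t ∈ Icc 0 T, ‖(u t : L2 d Ω)‖ ≤ B₁ := fun t ht => by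
    have h := norm_le_of_integral_deriv_sq_le hu hu'c ht (hu' t ht)
    exact h.trans (by linarith)
  have hΨuc : ContinuousOn (fun t => Ψ (u t)) (Icc 0 T) := hΨc.comp_continuousOn huc
  have hsol : IsSolution p δ T (discDivFree X Y) f u₀h fun t => (u t : L2 d Ω) := by
    refine ⟨(contDiffOn_one_iff_derivWithin (uniqueDiffOn_Icc hT)).2
      ⟨fun t ht => (hU t ht).differentiableWithinAt, hUdc⟩, fun t _ => (u t).2, fun t ht ξ hξ => ?_,
      by rw [hu0]⟩
    have h1 := hAconv (u t) ⟨ξ, hξ⟩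
    have h2 := hg t ⟨ξ, hξ⟩
    have h3 : inner ℝ ((g t - A (u t) : V) : L2 d Ω) ξ = inner ℝ (g t - A (u t)) (⟨ξ, hξ⟩ : V) :=
      rfl
    rw [hUd ht, h3, inner_sub_left, h2]
    linarith
  refine ⟨fun t => (u t : L2 d Ω), hsol, fun w hw t ht => ?_, fun t => Ψ (u t), fun t _ => ?_, ?_,
    ?_, ?_⟩
  -- Uniqueness: subtracting the equations and testing with `w - u`, monotonicity makes the inner
  -- product nonpositive, so the Gronwall bound applies with `K = 0` and zero initial value.
  · have hwd : ∀ t ∈ Icc 0 T, HasDerivWithinAt w (derivWithin w (Icc 0 T) t) (Icc 0 T) t :=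
      fun t ht => (hw.contDiffOn.differentiableOn one_ne_zero t ht).hasDerivWithinAt
    have h := norm_sq_le_of_inner_deriv_le (K := 0) (e := fun t => w t - (u t : L2 d Ω))
      (fun s hs => (hwd s hs).sub (hU s hs)) (fun s hs => ?_) ht
    · have h0 : w 0 - (u 0 : L2 d Ω) = 0 := by rw [hw.initial, hu0, sub_self]
      rw [h0] at h
      have h1 : ‖w t - (u t : L2 d Ω)‖ ^ 2 ≤ 0 := by simpa using h
      exact sub_eq_zero.1 (norm_eq_zero.1 (pow_eq_zero_iff two_ne_zero |>.1
        (le_antisymm h1 (sq_nonneg _))))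
    · let z : V := ⟨w s, hw.mem s hs⟩
      have h1 := hw.equation s hs _ (z - u s).2
      have h2 := hsol.equation s hs _ (z - u s).2
      have h3 := hAconv z (z - u s)
      have h4 := hAconv (u s) (z - u s)
      have h5 := hmono z (u s)
      rw [inner_sub_left] at h5
      rw [hUd hs] at h2
      have h6 : w s - (u s : L2 d Ω) = ((z - u s : V) : L2 d Ω) := rfl
      rw [zero_mul, real_inner_comm, inner_sub_left, h6]
      linarith
  · filter_upwards [hΨ (u t), hLgrad (u t)] with x h1 h2
    rw [h1, h2]
  · exact (hΨuc.mono Ioo_subset_Icc_self).aestronglyMeasurable measurableSet_Ioo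
  · have h1 := eLpNorm_top_timeMeas_le huB
    have h2 : eLpNorm (fun t => Ψ (u t)) 2 (timeMeas T) ≤ ENNReal.ofReal √(T * B₂ ^ 2) := by
      rw [eLpNorm_two_timeMeas hT.le hΨuc]
      refine ENNReal.ofReal_le_ofReal (Real.sqrt_le_sqrt ?_)
      have h := intervalIntegral.integral_mono_on hT.le
        (((hΨuc.norm.pow 2).mono (uIcc_of_le hT.le).subset).intervalIntegrable (μ := volume))
        (intervalIntegrable_const (c := B₂ ^ 2)) fun s hs =>
        pow_le_pow_left₀ (norm_nonneg _) (hΨB s hs) 2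
      simpa using h
    refine (add_le_add h1 h2).trans ?_
    rw [← ENNReal.ofReal_add hB₁ (Real.sqrt_nonneg _)]
    exact ENNReal.ofReal_le_ofReal (le_add_of_nonneg_right (by positivity))
  · have h1 : eLpNorm (derivWithin (fun t => (u t : L2 d Ω)) (Icc 0 T)) 2 (timeMeas T)
        ≤ ENNReal.ofReal √(2 * E₀) := by
      rw [eLpNorm_two_timeMeas hT.le hUdc]
      refine ENNReal.ofReal_le_ofReal (Real.sqrt_le_sqrt ?_)
      refine le_of_eq_of_le (intervalIntegral.integral_congr fun s hs => ?_)
        (hu' T (right_mem_Icc.2 hT.le))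
      rw [uIcc_of_le hT.le] at hs
      simp only [hUd hs, Submodule.coe_norm]
    refine (add_le_add h1 (eLpNorm_top_timeMeas_le hΨB)).trans ?_
    rw [← ENNReal.ofReal_add (Real.sqrt_nonneg _) hB₂]
    exact ENNReal.ofReal_le_ofReal (le_add_of_nonneg_left (by positivity))
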